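/- Let $P\ll Q$ be probability measures on a measurable space $\mathcal Z$, and let $\mathcal H$ be a reproducing kernel Hilbert space of real functions on $\mathcal Z$ with measurable kernel $k$, bounded by $K$ everywhere. Let $\mu_P,\mu_Q\in\mathcal H$ be the kernel mean embeddings ($\langle f,\mu_P\rangle=\mathbb E_P f$) and $\Sigma_Q$ the covariance operator ($\langle f,\Sigma_Q g\rangle=\mathbb E_Q[fg]$). Assume that $\frac{dP}{dQ}-1$ coincides $Q$-a.e. with an element of $\mathcal H$, and that $\mu_P-\mu_Q\in\mathrm{Ran}(\Sigma_Q^\theta)$ for some $\theta\in(1,2]$. Let $X_1,\dots,X_m,\widetilde X_1,\dots,\widetilde X_{\widetilde m}\sim P$ and $Y_1,\dots,Y_n,\widetilde Y_1,\dots,\widetilde Y_{\widetilde n}\sim Q$ be independent samples with balanced positive sizes ($m\asymp n$, $\widetilde m\asymp\widetilde n$, with a fixed constant $b$), let $N=\min(m,n)$, $\widetilde N=\min(\widetilde m,\widetilde n)$, $\lambda=N^{-1/(2(\theta+1))}$, and define, with $L=n\lambda I+k_{\mathbf Y\mathbf Y}$, $$\widehat r_\lambda(u)=\tfrac1{m\lambda}k_{u\mathbf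 X}\mathbf 1_m-\tfrac1{n\lambda}k_{u\mathbf Y}\mathbf 1_n-\tfrac1{m\lambda}k_{u\mathbf Y}L^{-1}k_{\mathbf Y\mathbf X}\mathbf 1_m+\tfrac1{n\lambda}k_{u\mathbf Y}L^{-1}k_{\mathbf Y\mathbf Y}\mathbf 1_n+1,$$ where $k_{\mathbf Y\mathbf X}=(k(Y_i,X_j))_{i,j}$, $k_{u\mathbf X}=(k(u,X_i))_i$, etc. For convex $f$ on $(0,\infty)$ let $f'$ be its right derivative, $f^*(u)=\sup_{t>0}\{ut-f(t)\}$, $D_f=\int f(\frac{dP}{dQ})\,dQ$ and $$\widehat D_{f,\lambda}=\tfrac1{\widetilde m}\sum_{i=1}^{\widetilde m} f'(\widehat r_\lambda(\widetilde X_i))-\tfrac1{\widetilde n}\sum_{j=1}^{\widetilde n} f^*(f'(\widehat r_\lambda(\widetilde Y_j))).$$ Then there is a constant $\mathsf C>0$, depending only on $P,Q,k,\theta$ and $b$, such that in each of the following cases there is a constant $A>0$, independent of the sample sizes and of $\eta$, such that for all such sample sizes and all $\eta\in(0,e^{-1})$ satisfying the stated conditions, with probability at least $1-\eta$, $$|\widehat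 D_{f,\lambda}-D_f|\le A\left(N^{-\frac{\theta-1}{2(\theta+1)}}+\widetilde N^{-1/2}\right)\sqrt{\ln(1/\eta)}.$$ 1. $f$ is convex and $C^2$ on $(0,\infty)$ with $f(1)=0$; $\frac{dP}{dQ}\in[c,C]$ $Q$-a.e. for some $0<c<1<C<\infty$; and $\mathsf C N^{-\frac{\theta-1}{2(\theta+1)}}\sqrt{\ln(1/\eta)}\le c/2$. 2. $f(t)=\frac12|t-1|$ (Total Variation, set $\gamma=1$) or $f(t)=\max(t-\gamma,0)$ with $\gamma>0$ (Hockey-Stick); for fresh points $X\sim P$ and $Y\sim Q$ independent of the samples, $\widehat r_\lambda(X)$ and $\widehat r_\lambda(Y)$ have densities on $[\gamma/2,3\gamma/2]$ bounded there by a constant $G$; and $\mathsf C N^{-\frac{\theta-1}{2(\theta+1)}}\sqrt{\ln(1/\eta)}\le\gamma/2$. Here $A$ may also depend on $G$ and $\gamma$. -/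

import Mathlib

open MeasureTheory Set
open scoped ENNReal

noncomputable section

namespace FDivEst

/-! ### Kernel, mean embedding and covariance operator -/

section RKHSPart

variable {Z : Type*} (H : Type*) [NormedAddCommGroup H] [InnerProductSpace ℝ H]
  [CompleteSpace H] [RKHS ℝ H Z ℝ]

/-- The feature map `φ(x) = k(x, ·)` of the reproducing kernel Hilbert space `H`. -/
def feature (x : Z) : H := RKHS.kerFun H x (1 : ℝ)

/-- The (scalar) reproducing kernel `k(x, y)` of the reproducing kernel Hilbert space `H`. -/
def ker (x y : Z) : ℝ := RKHS.kernel H x y (1 : ℝ)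

variable {H} in
theorem inner_feature (f : H) (x : Z) : inner ℝ f (feature H x) = f x := by
  simp [feature]

theorem feature_apply (x y : Z) : feature H y x = ker H x y := by
  simp [feature, ker, RKHS.kerFun_apply]

theorem inner_feature_feature (x y : Z) :
    inner ℝ (feature H x) (feature H y) = ker H x y := by
  rw [real_inner_comm, inner_feature, feature_apply]

variable {H} in
theorem abs_coe_le {K : ℝ} (hK : ∀ x y : Z, |ker H x y| ≤ K) (f : H) (x : Z) :
    |f x| ≤ √K * ‖f‖ := by
  have h1 : ‖feature H x‖ ≤ √K := by
    refine Real.le_sqrt_of_sq_le ?_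
    rw [← real_inner_self_eq_norm_sq, inner_feature_feature]
    exact (le_abs_self _).trans (hK x x)
  rw [← inner_feature f x, mul_comm]
  exact (abs_real_inner_le_norm _ _).trans (by gcongr)

variable [MeasurableSpace Z]

open Classical in
/-- The kernel mean embedding of `P`: the element `μ_P` of `H` with
`⟨f, μ_P⟩ = ∫ f dP` for all `f ∈ H` (see `inner_meanEmbedding` for its existence). -/
def meanEmbedding (P : Measure Z) : H :=
  if h : ∃ μ : H, ∀ f : H, inner ℝ f μ = ∫ x, f x ∂P then h.choose else 0

open Classical in
/-- The (uncentered) covariance operator of `Q`: the bounded operator `Σ_Q` on `H` with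
`⟨f, Σ_Q g⟩ = ∫ f g dQ` for all `f, g ∈ H` (see `inner_covOp` for its existence). -/
def covOp (Q : Measure Z) : H →L[ℝ] H :=
  if h : ∃ S : H →L[ℝ] H, ∀ f g : H, inner ℝ f (S g) = ∫ x, f x * g x ∂Q then h.choose else 0

variable {H}

theorem measurable_coe (hk : Measurable fun p : Z × Z => ker H p.1 p.2) (f : H) :
    Measurable (f : Z → ℝ) := by
  have hf : f ∈ closure ((Submodule.span ℝ {RKHS.kerFun H x v | (x : Z) (v : ℝ)} :
      Submodule ℝ H) : Set H) := by
    rw [← Submodule.topologicalClosure_coe, RKHS.kerFun_dense]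
    simp
  obtain ⟨u, hu, hlim⟩ := mem_closure_iff_seq_limit.1 hf
  refine measurable_of_tendsto_metrizable (f := fun n => (u n : Z → ℝ)) (fun n => ?_) ?_
  · refine Submodule.span_induction (p := fun (g : H) _ => Measurable (g : Z → ℝ)) ?_ ?_ ?_ ?_ (hu n)
    · rintro _ ⟨y, v, rfl⟩
      have h1 : (RKHS.kerFun H y v : H) = v • feature H y := by
        rw [feature, ← map_smul]; simp
      have h2 : (feature H y : Z → ℝ) = fun x => ker H x y := by
        ext x; exact feature_apply H x y
      rw [h1, RKHS.coe_smul, h2]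
      exact (hk.comp (measurable_id.prodMk measurable_const)).const_smul v
    · rw [RKHS.coe_zero]
      exact measurable_zero
    · intro g g' _ _ hg hg'
      rw [RKHS.coe_add]
      exact hg.add hg'
    · intro c g _ hg
      rw [RKHS.coe_smul]
      exact hg.const_smul c
  · rw [tendsto_pi_nhds]
    intro x
    exact ((RKHS.continuous_eval (𝕜 := ℝ) (H := H) x).tendsto f).comp hlim

theorem integrable_coe (hk : Measurable fun p : Z × Z => ker H p.1 p.2)
    {K : ℝ} (hK : ∀ x y : Z, |ker H x y| ≤ K) (P : Measure Z) [IsFiniteMeasure P] (f : H) :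
    Integrable (f : Z → ℝ) P :=
  Integrable.of_bound (measurable_coe hk f).aestronglyMeasurable (√K * ‖f‖)
    (Filter.Eventually.of_forall fun x => abs_coe_le hK f x)

theorem integrable_coe_mul (hk : Measurable fun p : Z × Z => ker H p.1 p.2)
    {K : ℝ} (hK : ∀ x y : Z, |ker H x y| ≤ K) (P : Measure Z) [IsFiniteMeasure P] (f g : H) :
    Integrable (fun x => f x * g x) P :=
  (integrable_coe hk hK P g).bdd_mul (measurable_coe hk f).aestronglyMeasurable
    (Filter.Eventually.of_forall fun x => abs_coe_le hK f x)

/-- For a measurable bounded kernel the mean embedding exists. -/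
theorem inner_meanEmbedding (hk : Measurable fun p : Z × Z => ker H p.1 p.2)
    {K : ℝ} (hK : ∀ x y : Z, |ker H x y| ≤ K) (P : Measure Z) [IsProbabilityMeasure P] (f : H) :
    inner ℝ f (meanEmbedding H P) = ∫ x, f x ∂P := by
  have hex : ∃ μ : H, ∀ f : H, inner ℝ f μ = ∫ x, f x ∂P := by
    let L : H →ₗ[ℝ] ℝ :=
      { toFun := fun f => ∫ x, f x ∂P
        map_add' := fun a b => by
          simp only [RKHS.coe_add, Pi.add_apply]
          exact integral_add (integrable_coe hk hK P a) (integrable_coe hk hK P b)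
        map_smul' := fun c a => by
          simp only [RKHS.coe_smul, Pi.smul_apply, RingHom.id_apply]
          exact integral_smul c _ }
    let L' : H →L[ℝ] ℝ := L.mkContinuous (√K) fun f => by
      have := norm_integral_le_of_norm_le_const (μ := P) (f := (f : Z → ℝ))
        (Filter.Eventually.of_forall fun x => abs_coe_le hK f x)
      simp only [probReal_univ, mul_one] at this
      exact this
    refine ⟨(InnerProductSpace.toDual ℝ H).symm L', fun f => ?_⟩
    rw [real_inner_comm, InnerProductSpace.toDual_symm_apply]
    rfl
  rw [meanEmbedding, dif_pos hex]
  exact hex.choose_spec f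

/-- For a measurable bounded kernel the covariance operator exists. -/
theorem inner_covOp (hk : Measurable fun p : Z × Z => ker H p.1 p.2)
    {K : ℝ} (hK : ∀ x y : Z, |ker H x y| ≤ K) (Q : Measure Z) [IsProbabilityMeasure Q] (f g : H) :
    inner ℝ f (covOp H Q g) = ∫ x, f x * g x ∂Q := by
  have hex : ∃ S : H →L[ℝ] H, ∀ f g : H, inner ℝ f (S g) = ∫ x, f x * g x ∂Q := by
    let B : H →ₗ[ℝ] H →ₗ[ℝ] ℝ := LinearMap.mk₂ ℝ (fun f g => ∫ x, f x * g x ∂Q)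
      (fun a b g => by
        simp only [RKHS.coe_add, Pi.add_apply, add_mul]
        exact integral_add (integrable_coe_mul hk hK Q a g) (integrable_coe_mul hk hK Q b g))
      (fun c a g => by
        simp only [RKHS.coe_smul, Pi.smul_apply, smul_eq_mul, mul_assoc]
        exact integral_const_mul c _)
      (fun g a b => by
        simp only [RKHS.coe_add, Pi.add_apply, mul_add]
        exact integral_add (integrable_coe_mul hk hK Q g a) (integrable_coe_mul hk hK Q g b))
      (fun c g a => by
        simp only [RKHS.coe_smul, Pi.smul_apply, smul_eq_mul, mul_left_comm _ c]
        exact integral_const_mul c _)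
    let B' : H →L[ℝ] H →L[ℝ] ℝ := B.mkContinuous₂ (√K * √K) fun f g => by
      have := norm_integral_le_of_norm_le_const (μ := Q) (f := fun x => f x * g x)
        (C := (√K * ‖f‖) * (√K * ‖g‖))
        (Filter.Eventually.of_forall fun x => by
          rw [norm_mul]
          exact mul_le_mul (abs_coe_le hK f x) (abs_coe_le hK g x) (norm_nonneg _)
            (by positivity))
      simp only [probReal_univ, mul_one] at this
      refine this.trans (le_of_eq (by ring))
    refine ⟨InnerProductSpace.continuousLinearMapOfBilin (𝕜 := ℝ) B', fun f g => ?_⟩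
    rw [real_inner_comm, InnerProductSpace.continuousLinearMapOfBilin_apply]
    change ∫ x, g x * f x ∂Q = _
    simp only [mul_comm]
  rw [covOp, dif_pos hex]
  exact hex.choose_spec f g

end RKHSPart

/-! ### Real powers of a positive operator -/

section Power

variable {H : Type*} [NormedAddCommGroup H] [InnerProductSpace ℝ H]

/-- `T = S ^ θ` for a positive operator `S` with an orthonormal eigenbasis (every compact positive
operator, in particular every covariance operator): `T` is the bounded operator which is diagonal
in an orthonormal eigenbasis of `S`, with eigenvalues `σ ^ θ` in place of `σ ≥ 0`. -/
def IsPower (S T : H →L[ℝ] H) (θ : ℝ) : Prop :=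
  ∃ (s : Set H) (e : HilbertBasis s ℝ H) (σ : s → ℝ),
    ∀ i, 0 ≤ σ i ∧ S (e i) = σ i • e i ∧ T (e i) = (σ i ^ θ) • e i

/-- The range of `S ^ θ`. -/
def powRange (S : H →L[ℝ] H) (θ : ℝ) : Set H :=
  {v | ∃ T : H →L[ℝ] H, IsPower S T θ ∧ v ∈ Set.range T}

end Power

/-! ### f-divergences -/

/-- The density `dP/dQ`, as a real-valued function. -/
def ratio {Z : Type*} [MeasurableSpace Z] (P Q : Measure Z) (z : Z) : ℝ :=
  (P.rnDeriv Q z).toReal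

/-- `D_f(P ‖ Q) = ∫ f(dP/dQ) dQ` (for `P ≪ Q`). -/
def fDiv {Z : Type*} [MeasurableSpace Z] (f : ℝ → ℝ) (P Q : Measure Z) : ℝ :=
  ∫ z, f (ratio P Q z) ∂Q

/-- `f'` as a right derivative: it is the derivative wherever `f` is differentiable, and at a
kink it is the value from the right (`f'(1) = 1/2` for `f(t) = |t - 1| / 2` and `f'(γ) = 1` for
`f(t) = max (t - γ) 0`). -/
def rderiv (f : ℝ → ℝ) (t : ℝ) : ℝ := derivWithin f (Ioi t) t

/-- The convex conjugate `f^*(u) = sup_{t > 0} (u t - f(t))` of `f : (0, ∞) → ℝ`. -/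
def conj (f : ℝ → ℝ) (u : ℝ) : ℝ := ⨆ t : Ioi (0 : ℝ), (u * t - f t)

/-- The generator of the total variation. -/
def tvGen (t : ℝ) : ℝ := |t - 1| / 2

/-- The generator of the Hockey-Stick divergence with parameter `γ`. -/
def hsGen (γ t : ℝ) : ℝ := max (t - γ) 0

/-! ### The estimators -/

section Estimator

variable {Z : Type*} (H : Type*) [NormedAddCommGroup H] [InnerProductSpace ℝ H]
  [CompleteSpace H] [RKHS ℝ H Z ℝ]

/-- The kernel matrix `(k(x_i, y_j))_{i,j}`. -/
def gram {a b : ℕ} (x : Fin a → Z) (y : Fin b → Z) : Matrix (Fin a) (Fin b) ℝ :=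
  Matrix.of fun i j => ker H (x i) (y j)

/-- The kernel vector `(k(u, x_i))_i`. -/
def kvec {a : ℕ} (u : Z) (x : Fin a → Z) : Fin a → ℝ := fun i => ker H u (x i)

/-- The matrix `L_{yy,lam} = n lam I + k_{yy}`. -/
def regGram {n : ℕ} (lam : ℝ) (y : Fin n → Z) : Matrix (Fin n) (Fin n) ℝ :=
  ((n : ℝ) * lam) • (1 : Matrix (Fin n) (Fin n) ℝ) + gram H y y

open Matrix in
/-- The regularized likelihood-ratio estimator of `dP/dQ`, built from `x` (sampled from `P`) and
`y` (sampled from `Q`). -/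
def ratioEst {m n : ℕ} (lam : ℝ) (x : Fin m → Z) (y : Fin n → Z) (u : Z) : ℝ :=
  1 / ((m : ℝ) * lam) * (kvec H u x ⬝ᵥ 1)
    - 1 / ((n : ℝ) * lam) * (kvec H u y ⬝ᵥ 1)
    - 1 / ((m : ℝ) * lam) * (kvec H u y ⬝ᵥ ((regGram H lam y)⁻¹ *ᵥ (gram H y x *ᵥ 1)))
    + 1 / ((n : ℝ) * lam) * (kvec H u y ⬝ᵥ ((regGram H lam y)⁻¹ *ᵥ (gram H y y *ᵥ 1)))
    + 1

/-- The plug-in variational estimator of `D_f(P ‖ Q)`; `x, y` are used for the ratio, `x', y'`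
for the expectations. -/
def divEst {m n m' n' : ℕ} (f : ℝ → ℝ) (lam : ℝ) (x : Fin m → Z) (y : Fin n → Z)
    (x' : Fin m' → Z) (y' : Fin n' → Z) : ℝ :=
  1 / (m' : ℝ) * ∑ i, rderiv f (ratioEst H lam x y (x' i))
    - 1 / (n' : ℝ) * ∑ j, conj f (rderiv f (ratioEst H lam x y (y' j)))

/-- The regularization parameter `N ^ (-1 / (2 (θ + 1)))` with `N = min m n`. -/
def regParam (θ : ℝ) (m n : ℕ) : ℝ := ((min m n : ℕ) : ℝ) ^ (-1 / (2 * (θ + 1)))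

/-- The rate `N ^ (-(θ - 1) / (2 (θ + 1)))` with `N = min m n`. -/
def rate (θ : ℝ) (m n : ℕ) : ℝ := ((min m n : ℕ) : ℝ) ^ (-(θ - 1) / (2 * (θ + 1)))

variable [MeasurableSpace Z]

/-- The joint law of the independent samples `X_1, …, X_m ∼ P`, `Y_1, …, Y_n ∼ Q`,
`X'_1, …, X'_{m'} ∼ P`, `Y'_1, …, Y'_{n'} ∼ Q`. -/
def sampleLaw (P Q : Measure Z) (m n m' n' : ℕ) :
    Measure ((Fin m → Z) × (Fin n → Z) × (Fin m' → Z) × (Fin n' → Z)) :=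
  (Measure.pi fun _ => P).prod ((Measure.pi fun _ => Q).prod
    ((Measure.pi fun _ => P).prod (Measure.pi fun _ => Q)))

/-- The law of the estimated ratio evaluated at a fresh point: the samples `X ∼ P^m`, `Y ∼ Q^n`
and the point `U ∼ R` are independent. -/
def ratioEstLaw (P Q R : Measure Z) (m n : ℕ) (lam : ℝ) : Measure ℝ :=
  Measure.map (fun p : (Fin m → Z) × (Fin n → Z) × Z => ratioEst H lam p.1 p.2.1 p.2.2)
    ((Measure.pi fun _ => P).prod ((Measure.pi fun _ => Q).prod R))

/-- With probability at least `1 - η` over the samples,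
`|D̂_f - D_f| ≤ A (N ^ (-(θ - 1) / (2 (θ + 1))) + N' ^ (-1/2)) √(ln (1/η))`,
where `N = min m n` and `N' = min m' n'`. -/
def DivergenceBound (f : ℝ → ℝ) (P Q : Measure Z) (θ A η : ℝ) (m n m' n' : ℕ) : Prop :=
  sampleLaw P Q m n m' n'
    {ω | ¬ |divEst H f (regParam θ m n) ω.1 ω.2.1 ω.2.2.1 ω.2.2.2 - fDiv f P Q|
        ≤ A * (rate θ m n + ((min m' n' : ℕ) : ℝ) ^ (-(1 / 2) : ℝ)) * √(Real.log (1 / η))}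
    ≤ ENNReal.ofReal η

end Estimator

/-- On the set `s` the measure `ν` has a density, which is bounded there by `G`. -/
def HasBoundedDensityOn (ν : Measure ℝ) (s : Set ℝ) (G : ℝ) : Prop :=
  ∃ p : ℝ → ℝ≥0∞, Measurable p ∧ (∀ t ∈ s, p t ≤ ENNReal.ofReal G) ∧
    ν.restrict s = (volume.withDensity p).restrict s

/-- The sample sizes are positive and balanced, `m ≍ n` and `m' ≍ n'`, with constant `b`. -/
def Balanced (b : ℝ) (m n m' n' : ℕ) : Prop :=
  (1 ≤ m ∧ 1 ≤ n ∧ 1 ≤ m' ∧ 1 ≤ n') ∧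
  ((m : ℝ) ≤ b * n ∧ (n : ℝ) ≤ b * m) ∧ ((m' : ℝ) ≤ b * n' ∧ (n' : ℝ) ≤ b * m')

end FDivEst

end

noncomputable section

namespace FDivEst

open ProbabilityTheory

/-! Write `h` for `dP/dQ - 1` in `H` and `S` for the covariance operator of `Q`, so that `μ_P - μ_Q
= S h`. By `exists_ratioEst_eq`, the estimated ratio is `v + 1`, where `v` solves the Tikhonov
equation `(lam + Ŝ) v = μ̂_X - μ̂_Y` and `Ŝ` is the empirical covariance of the `Y` sample. Let `k`
solve the population equation `(lam + S) k = S h`.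

The bias `k - h` is `O(lam ^ (θ - 1))` by the source condition (`norm_sub_le_of_source`). For the
stochastic error, `(lam + Ŝ)(v - k)` is a difference of two centered averages, of `φ(X)` and of `(1
+ k(Y)) φ(Y)`. Since `k` is deterministic, vector concentration gives `O(N ^ (-1/2))`, and inverting
`lam + Ŝ` costs a factor `1 / lam`. With the chosen `lam` the bias dominates. The reproducing
property turns the norm bound into a uniform bound `ε` on the estimated ratio minus `r = h + 1`
(`exists_uniform_bound`).

Equality in Fenchel-Young gives `D_f = E_P f'(r) - E_Q f^*(f'(r))`. On the good event each estimated
integrand differs from its population version by at most a deterministic function `w`, so scalar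
concentration of the second samples for the population integrand and for `w` suffices
(`divergenceBound_of_close`). For `C²` generators `w` is a Lipschitz constant times `ε`. For step
derivatives `w` is a multiple of the indicator of `|r - γ| ≤ ε`; its mass is `O(ε)` because there
the estimated ratio lies within `2ε` of `γ` on the good event, where its law has a bounded density.
-/

theorem integrable_of_measurable_of_abs_le {Ω : Type*} [MeasurableSpace Ω] (μ : Measure Ω)
    [IsFiniteMeasure μ] {F : Ω → ℝ} (hF : Measurable F) {M : ℝ} (hM : ∀ x, |F x| ≤ M) :
    Integrable F μ :=
  Integrable.of_bound hF.aestronglyMeasurable M (Filter.Eventually.of_forall hM)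

theorem abs_integral_le_of_abs_le {Ω : Type*} [MeasurableSpace Ω] (μ : Measure Ω)
    [IsProbabilityMeasure μ] {F : Ω → ℝ} {M : ℝ} (hM : ∀ x, |F x| ≤ M) :
    |∫ x, F x ∂μ| ≤ M := by
  have := norm_integral_le_of_norm_le_const (μ := μ) (f := F) (Filter.Eventually.of_forall hM)
  simpa using this

/-! ### Bounded differences inequality -/

section Concentration

variable {Z : Type*} [MeasurableSpace Z] (P : Measure Z) [IsProbabilityMeasure P]

/-- The bounded differences inequality of McDiarmid, at the level of moment generating functions
and with a non-optimal constant. -/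
theorem integral_exp_le_of_bounded_differences {c : ℝ} (t : ℝ) :
    ∀ (n : ℕ) (F : (Fin n → Z) → ℝ), Measurable F → ∀ M : ℝ, (∀ x, |F x| ≤ M) →
    (∀ i x z, |F (Function.update x i z) - F x| ≤ c) →
    ∫ x, Real.exp (t * (F x - ∫ y, F y ∂(Measure.pi fun _ => P))) ∂(Measure.pi fun _ => P)
      ≤ Real.exp (n * c ^ 2 * t ^ 2 / 2) := by
  intro n
  induction n with
  | zero =>
    intro F hF M hM hc
    have h1 : ∀ x y : Fin 0 → Z, F x = F y := fun x y => by rw [Subsingleton.elim x y]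
    have h2 : ∀ x : Fin 0 → Z, F x - ∫ y, F y ∂(Measure.pi fun _ => P) = 0 := fun x => by
      have : (fun y => F y) = fun _ => F x := by ext y; exact h1 y x
      rw [this]; simp
    simp [h2]
  | succ n ih =>
    intro F hF M hM hc
    set π : Measure (Fin n → Z) := Measure.pi fun _ => P with hπ
    have hmp := (measurePreserving_piFinSuccAbove (fun _ : Fin (n + 1) => P) 0).symm
    let e : Z × (Fin n → Z) ≃ᵐ (Fin (n + 1) → Z) :=
      (MeasurableEquiv.piFinSuccAbove (fun _ => Z) 0).symm
    have hmp : MeasurePreserving e (P.prod π) (Measure.pi fun _ => P) := hmp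
    have he : ∀ p, e p = Fin.cons p.1 p.2 := fun p => by
      simp [e, MeasurableEquiv.piFinSuccAbove, Fin.insertNthEquiv]
    have hFe : Measurable fun p => F (e p) := hF.comp e.measurable
    -- Martingale step: `g` is the mean of `F` given the first coordinate. The induction hypothesis
    -- controls `F - g` on each slice, and Hoeffding's lemma controls `g - m`.
    let g : Z → ℝ := fun z => ∫ r, F (e (z, r)) ∂π
    have hg : Measurable g :=
      (hFe.stronglyMeasurable.integral_prod_right (ν := π)).measurable
    have hgM : ∀ z, |g z| ≤ M := fun z => abs_integral_le_of_abs_le π fun r => hM _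
    have hint : ∀ z, Integrable (fun r => F (e (z, r))) π := fun z =>
      integrable_of_measurable_of_abs_le π (hFe.comp measurable_prodMk_left) fun r => hM _
    have hgc : ∀ z z', |g z - g z'| ≤ c := fun z z' => by
      rw [← integral_sub (hint z) (hint z')]
      refine abs_integral_le_of_abs_le π fun r => ?_
      have := hc 0 (e (z', r)) z
      rwa [he, Fin.update_cons_zero, ← he (z, r), ← he] at this
    have hEF : ∫ y, F y ∂(Measure.pi fun _ => P) = ∫ z, g z ∂P := by
      rw [← hmp.integral_comp' (g := F), integral_prod]
      exact integrable_of_measurable_of_abs_le _ hFe fun r => hM _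
    set m := ∫ z, g z ∂P
    have hmM : |m| ≤ M := abs_integral_le_of_abs_le P hgM
    rw [hEF, ← hmp.integral_comp' (g := fun x => Real.exp (t * (F x - m)))]
    have hbd : ∀ p : Z × (Fin n → Z), |Real.exp (t * (F (e p) - m))| ≤ Real.exp (|t| * (2 * M)) :=
      fun p => by
        rw [Real.abs_exp]
        refine Real.exp_le_exp.2 ((le_abs_self _).trans ?_)
        rw [abs_mul]
        refine mul_le_mul_of_nonneg_left ?_ (abs_nonneg _)
        have := abs_sub (F (e p)) m
        linarith [hM (e p)]
    have hexpm : Measurable fun p : Z × (Fin n → Z) => Real.exp (t * (F (e p) - m)) :=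
      Real.measurable_exp.comp ((hFe.sub_const m).const_mul t)
    rw [integral_prod _ (integrable_of_measurable_of_abs_le _ hexpm hbd)]
    have hinner : ∀ z, ∫ r, Real.exp (t * (F (e (z, r)) - m)) ∂π
        ≤ Real.exp (n * c ^ 2 * t ^ 2 / 2) * Real.exp (t * (g z - m)) := fun z => by
      have h1 := ih (fun r => F (e (z, r))) (hFe.comp measurable_prodMk_left) M (fun r => hM _)
        (fun i r w => by
          have := hc i.succ (e (z, r)) w
          rw [he, ← Fin.cons_update, ← he (z, r)] at this
          rwa [he])
      have h2 : ∀ r, Real.exp (t * (F (e (z, r)) - m))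
          = Real.exp (t * (F (e (z, r)) - g z)) * Real.exp (t * (g z - m)) := fun r => by
        rw [← Real.exp_add]; ring_nf
      simp only [h2]
      rw [integral_mul_const]
      exact mul_le_mul_of_nonneg_right h1 (Real.exp_pos _).le
    obtain ⟨z₀⟩ : Nonempty Z := P.nonempty_of_neZero
    -- Comparison with a single point `z₀` confines `g` to an interval of length `2c`, whence the
    -- parameter `c ^ 2` instead of the optimal `c ^ 2 / 4`.
    have hsub := hasSubgaussianMGF_of_mem_Icc (μ := P) (X := g) (a := g z₀ - c) (b := g z₀ + c)
      hg.aemeasurable (Filter.Eventually.of_forall fun z => by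
        have := abs_le.1 (hgc z z₀)
        constructor <;> linarith)
    have hmgf := hsub.mgf_le t
    have hcoef : ((((‖g z₀ + c - (g z₀ - c)‖₊ / 2) ^ 2 : NNReal) : ℝ)) = c ^ 2 := by
      push_cast
      rw [show g z₀ + c - (g z₀ - c) = 2 * c by ring, Real.norm_eq_abs, abs_mul, div_pow, mul_pow,
        sq_abs, sq_abs]
      ring
    rw [hcoef] at hmgf
    calc ∫ z, ∫ r, Real.exp (t * (F (e (z, r)) - m)) ∂π ∂P
        ≤ ∫ z, Real.exp (n * c ^ 2 * t ^ 2 / 2) * Real.exp (t * (g z - m)) ∂P := by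
          refine integral_mono_of_nonneg (Filter.Eventually.of_forall fun z =>
            integral_nonneg fun r => (Real.exp_pos _).le) ?_ (Filter.Eventually.of_forall hinner)
          exact (hsub.integrable_exp_mul t).const_mul _
      _ = Real.exp (n * c ^ 2 * t ^ 2 / 2) * mgf (fun z => g z - m) P t := by
          rw [integral_const_mul]; rfl
      _ ≤ Real.exp (n * c ^ 2 * t ^ 2 / 2) * Real.exp (c ^ 2 * t ^ 2 / 2) :=
          mul_le_mul_of_nonneg_left hmgf (Real.exp_pos _).le
      _ = Real.exp ((n + 1 : ℕ) * c ^ 2 * t ^ 2 / 2) := by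
          rw [← Real.exp_add]; push_cast; ring_nf

/-- The bounded differences inequality of McDiarmid, with a non-optimal constant. -/
theorem measure_ge_le_of_bounded_differences {n : ℕ} {F : (Fin n → Z) → ℝ} (hF : Measurable F)
    {M : ℝ} (hM : ∀ x, |F x| ≤ M) {c : NNReal}
    (hc : ∀ i x z, |F (Function.update x i z) - F x| ≤ c) {ε : ℝ} (hε : 0 ≤ ε) :
    (Measure.pi fun _ => P).real
        {x | ε ≤ F x - ∫ y, F y ∂(Measure.pi fun _ => P)}
      ≤ Real.exp (-ε ^ 2 / (2 * (n * c ^ 2))) := by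
  have hsub : HasSubgaussianMGF (fun x => F x - ∫ y, F y ∂(Measure.pi fun _ => P))
      (n * c ^ 2 : NNReal) (Measure.pi fun _ => P) := by
    refine ⟨fun t => ?_, fun t => ?_⟩
    · exact integrable_exp_mul_of_mem_Icc (a := -M - ∫ y, F y ∂(Measure.pi fun _ => P))
        (b := M - ∫ y, F y ∂(Measure.pi fun _ => P)) (hF.sub_const _).aemeasurable
        (Filter.Eventually.of_forall fun x => by
          have := abs_le.1 (hM x)
          constructor <;> linarith)
    · exact integral_exp_le_of_bounded_differences P t n F hF M hM hc
  exact hsub.measure_ge_le hε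

/-! ### Averages of bounded centered random vectors -/

section Hilbert

variable {E : Type*} [NormedAddCommGroup E] [InnerProductSpace ℝ E]

theorem sq_norm_average {Z : Type*} {n : ℕ} (ζ : Z → E) (x : Fin n → Z) :
    ‖(1 / (n : ℝ)) • ∑ i, ζ (x i)‖ ^ 2
      = (1 / (n : ℝ)) ^ 2 * ∑ i, ∑ j, inner ℝ (ζ (x i)) (ζ (x j)) := by
  rw [norm_smul, mul_pow, Real.norm_eq_abs, sq_abs, ← real_inner_self_eq_norm_sq, sum_inner]
  simp only [inner_sum]

theorem measurable_inner_eval {n : ℕ} {ζ : Z → E}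
    (hζ : Measurable fun p : Z × Z => (inner ℝ (ζ p.1) (ζ p.2) : ℝ)) (i j : Fin n) :
    Measurable fun x : Fin n → Z => (inner ℝ (ζ (x i)) (ζ (x j)) : ℝ) := by
  have h : Measurable fun x : Fin n → Z => (x i, x j) :=
    (measurable_pi_apply i).prodMk (measurable_pi_apply j)
  exact hζ.comp h

/-- Expanding the square leaves only pairwise inner products, so measurability of these suffices: no
separability of `E` and no measurability of `ζ` is involved. Likewise, centering is only used weakly
below. -/
theorem measurable_norm_average {n : ℕ} {ζ : Z → E}
    (hζ : Measurable fun p : Z × Z => (inner ℝ (ζ p.1) (ζ p.2) : ℝ)) :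
    Measurable fun x : Fin n → Z => ‖(1 / (n : ℝ)) • ∑ i, ζ (x i)‖ := by
  have h : (fun x : Fin n → Z => ‖(1 / (n : ℝ)) • ∑ i, ζ (x i)‖)
      = fun x => √((1 / (n : ℝ)) ^ 2 * ∑ i, ∑ j, inner ℝ (ζ (x i)) (ζ (x j))) := by
    ext x
    rw [← sq_norm_average, Real.sqrt_sq (norm_nonneg _)]
  rw [h]
  refine Measurable.sqrt (Measurable.const_mul ?_ _)
  refine Finset.measurable_sum _ fun i _ => Finset.measurable_sum _ fun j _ => ?_
  exact measurable_inner_eval hζ i j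

theorem norm_average_le {Z : Type*} {n : ℕ} {ζ : Z → E} {B : ℝ} (hn : 0 < n) (hB : ∀ z, ‖ζ z‖ ≤ B)
    (x : Fin n → Z) : ‖(1 / (n : ℝ)) • ∑ i, ζ (x i)‖ ≤ B := by
  have hn' : (0 : ℝ) < n := Nat.cast_pos.2 hn
  rw [norm_smul, Real.norm_of_nonneg (by positivity)]
  have : ‖∑ i, ζ (x i)‖ ≤ n * B := by
    refine (norm_sum_le _ _).trans ((Finset.sum_le_sum fun i _ => hB (x i)).trans ?_)
    simp
  calc 1 / (n : ℝ) * ‖∑ i, ζ (x i)‖ ≤ 1 / (n : ℝ) * (n * B) := by gcongr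
    _ = B := by field_simp

/-- Distinct coordinates are independent, so Fubini applies; with the first vector fixed, the inner
integral vanishes by weak centering. -/
theorem integral_inner_eval_eq_zero {n : ℕ} {ζ : Z → E} {B : ℝ} (hB : ∀ z, ‖ζ z‖ ≤ B)
    (hζ : Measurable fun p : Z × Z => (inner ℝ (ζ p.1) (ζ p.2) : ℝ))
    (h0 : ∀ v : E, ∫ z, inner ℝ v (ζ z) ∂P = 0) {i j : Fin n} (hij : i ≠ j) :
    ∫ x : Fin n → Z, inner ℝ (ζ (x i)) (ζ (x j)) ∂(Measure.pi fun _ => P) = 0 := by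
  have hind : IndepFun (fun x : Fin n → Z => x i) (fun x => x j) (Measure.pi fun _ => P) :=
    (iIndepFun_pi (μ := fun _ : Fin n => P) (X := fun _ => id)
      (fun _ => aemeasurable_id)).indepFun hij
  have hmap := (indepFun_iff_map_prod_eq_prod_map_map (measurable_pi_apply i).aemeasurable
    (measurable_pi_apply j).aemeasurable).1 hind
  rw [(measurePreserving_eval (fun _ : Fin n => P) i).map_eq,
    (measurePreserving_eval (fun _ : Fin n => P) j).map_eq] at hmap
  have h1 := integral_map (μ := Measure.pi fun _ : Fin n => P)
    ((measurable_pi_apply i).prodMk (measurable_pi_apply j)).aemeasurable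
    (f := fun p : Z × Z => (inner ℝ (ζ p.1) (ζ p.2) : ℝ)) hζ.aestronglyMeasurable
  rw [hmap] at h1
  rw [← h1, integral_prod]
  · simp [h0]
  · refine integrable_of_measurable_of_abs_le _ hζ (M := B * B) fun p => ?_
    exact (abs_real_inner_le_norm _ _).trans
      (mul_le_mul (hB _) (hB _) (norm_nonneg _) ((norm_nonneg _).trans (hB p.1)))

/-- Cross terms vanish and the `n` diagonal terms are at most `B ^ 2`, so the second moment is at
most `B ^ 2 / n`; nonnegativity of the variance passes to the first moment. -/
theorem integral_norm_average_le {n : ℕ} {ζ : Z → E} {B : ℝ} (hn : 0 < n) (hB : ∀ z, ‖ζ z‖ ≤ B)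
    (hζ : Measurable fun p : Z × Z => (inner ℝ (ζ p.1) (ζ p.2) : ℝ))
    (h0 : ∀ v : E, ∫ z, inner ℝ v (ζ z) ∂P = 0) :
    ∫ x : Fin n → Z, ‖(1 / (n : ℝ)) • ∑ i, ζ (x i)‖ ∂(Measure.pi fun _ => P) ≤ B / √n := by
  have hn' : (0 : ℝ) < n := Nat.cast_pos.2 hn
  obtain ⟨z₀⟩ : Nonempty Z := P.nonempty_of_neZero
  have hB0 : 0 ≤ B := (norm_nonneg _).trans (hB z₀)
  set F : (Fin n → Z) → ℝ := fun x => ‖(1 / (n : ℝ)) • ∑ i, ζ (x i)‖ with hFdef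
  have hF : Measurable F := measurable_norm_average hζ
  have hFB : ∀ x, |F x| ≤ B := fun x => by
    rw [abs_of_nonneg (norm_nonneg _)]; exact norm_average_le hn hB x
  have hmem : MemLp F 2 (Measure.pi fun _ : Fin n => P) :=
    MemLp.of_bound hF.aestronglyMeasurable B (Filter.Eventually.of_forall hFB)
  have hvar := variance_eq_sub hmem
  have hnn := variance_nonneg F (Measure.pi fun _ : Fin n => P)
  have hmeas : ∀ i j : Fin n, Measurable fun x : Fin n → Z =>
      (inner ℝ (ζ (x i)) (ζ (x j)) : ℝ) := measurable_inner_eval hζ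
  have hbd : ∀ z w : Z, |(inner ℝ (ζ z) (ζ w) : ℝ)| ≤ B * B := fun z w =>
    (abs_real_inner_le_norm _ _).trans (mul_le_mul (hB _) (hB _) (norm_nonneg _) hB0)
  have hint : ∀ i j : Fin n, Integrable (fun x : Fin n → Z =>
      (inner ℝ (ζ (x i)) (ζ (x j)) : ℝ)) (Measure.pi fun _ : Fin n => P) := fun i j =>
    integrable_of_measurable_of_abs_le _ (hmeas i j) fun x => hbd _ _
  have hsq : ∫ x, (F ^ 2) x ∂(Measure.pi fun _ : Fin n => P) ≤ B ^ 2 / n := by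
    have h1 : ∀ x, (F ^ 2) x = (1 / (n : ℝ)) ^ 2 * ∑ i, ∑ j, inner ℝ (ζ (x i)) (ζ (x j)) :=
      fun x => sq_norm_average ζ x
    simp only [h1]
    rw [integral_const_mul, integral_finsetSum _ fun i _ => integrable_finsetSum _ fun j _ => hint i j]
    have h2 : ∀ i : Fin n, ∫ x : Fin n → Z, ∑ j, inner ℝ (ζ (x i)) (ζ (x j))
        ∂(Measure.pi fun _ : Fin n => P) ≤ B ^ 2 := fun i => by
      rw [integral_finsetSum _ fun j _ => hint i j, Finset.sum_eq_single i
        (fun j _ hj => integral_inner_eval_eq_zero P hB hζ h0 hj.symm) (by simp), sq]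
      exact (le_abs_self _).trans (abs_integral_le_of_abs_le _ fun x => hbd _ _)
    calc (1 / (n : ℝ)) ^ 2 * ∑ i, ∫ x : Fin n → Z, ∑ j, inner ℝ (ζ (x i)) (ζ (x j))
          ∂(Measure.pi fun _ : Fin n => P)
        ≤ (1 / (n : ℝ)) ^ 2 * ∑ _i : Fin n, B ^ 2 := by
          gcongr with i; exact h2 i
      _ = B ^ 2 / n := by simp; field_simp
  rw [hvar] at hnn
  refine abs_le_of_sq_le_sq' ?_ (by positivity) |>.2
  rw [div_pow, Real.sq_sqrt hn'.le]
  linarith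

/-- Concentration of the average of independent bounded centered random vectors. -/
theorem measure_norm_average_gt_le {n : ℕ} {ζ : Z → E} {B : ℝ} (hn : 0 < n)
    (hB : ∀ z, ‖ζ z‖ ≤ B)
    (hζ : Measurable fun p : Z × Z => (inner ℝ (ζ p.1) (ζ p.2) : ℝ))
    (h0 : ∀ v : E, ∫ z, inner ℝ v (ζ z) ∂P = 0) {η : ℝ} (hη : η ∈ Ioo 0 (Real.exp (-1))) :
    (Measure.pi fun _ : Fin n => P)
      {x | 7 * B * √(Real.log (1 / η)) / √n < ‖(1 / (n : ℝ)) • ∑ i, ζ (x i)‖}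
      ≤ ENNReal.ofReal (η / 8) := by
  have hn' : (0 : ℝ) < n := Nat.cast_pos.2 hn
  obtain ⟨z₀⟩ : Nonempty Z := P.nonempty_of_neZero
  have hB0 : 0 ≤ B := (norm_nonneg _).trans (hB z₀)
  set L := Real.log (1 / η) with hL
  have hL1 : 1 ≤ L := by
    rw [hL, one_div, Real.log_inv]
    have := Real.log_lt_log hη.1 hη.2
    rw [Real.log_exp] at this
    linarith
  have hηL : Real.exp (-L) = η := by
    rw [hL, one_div, Real.log_inv, neg_neg, Real.exp_log hη.1]
  -- The case `B = 0` is separate because the exponent computation divides by `B`.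
  rcases hB0.eq_or_lt with hB0' | hBpos
  · have : {x : Fin n → Z | 7 * B * √L / √n < ‖(1 / (n : ℝ)) • ∑ i, ζ (x i)‖} = ∅ := by
      ext x
      have := norm_average_le hn hB x
      simp only [mem_ofPred_eq, mem_empty_iff_false, iff_false, not_lt]
      rw [← hB0'] at this ⊢
      simpa using this
    rw [this]; simp
  set F : (Fin n → Z) → ℝ := fun x => ‖(1 / (n : ℝ)) • ∑ i, ζ (x i)‖ with hFdef
  have hF : Measurable F := measurable_norm_average hζ
  have hFB : ∀ x, |F x| ≤ B := fun x => by
    rw [abs_of_nonneg (norm_nonneg _)]; exact norm_average_le hn hB x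
  have hEF := integral_norm_average_le P hn hB hζ h0
  have hc : ∀ i (x : Fin n → Z) z, |F (Function.update x i z) - F x|
      ≤ (⟨2 * B / n, by positivity⟩ : NNReal) := fun i x z => by
    refine (abs_norm_sub_norm_le _ _).trans ?_
    rw [← smul_sub, ← Finset.sum_sub_distrib, Finset.sum_eq_single i
      (fun j _ hj => by rw [Function.update_of_ne hj, sub_self]) (by simp),
      Function.update_self, norm_smul, Real.norm_of_nonneg (by positivity)]
    have := (norm_sub_le (ζ z) (ζ (x i))).trans (add_le_add (hB _) (hB _))
    change 1 / (n : ℝ) * _ ≤ 2 * B / n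
    calc 1 / (n : ℝ) * ‖ζ z - ζ (x i)‖ ≤ 1 / (n : ℝ) * (B + B) := by gcongr
      _ = 2 * B / n := by ring
  -- The constant `7` splits as `6 + 1`: the mean costs `B / √n`, and the deviation `6B√L / √n` with
  -- differences `2B / n` has tail `exp (-9L/2)`, at most `η / 8` because `L ≥ 1`.
  set ε : ℝ := 6 * B * √L / √n with hε
  have hmain := measure_ge_le_of_bounded_differences P hF hFB hc (ε := ε) (by positivity)
  have hexp : -ε ^ 2 / (2 * (n * (2 * B / n) ^ 2)) = -(9 / 2) * L := by
    rw [hε, div_pow, mul_pow, Real.sq_sqrt hn'.le, Real.sq_sqrt (by linarith)]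
    field_simp
    norm_num
  have h8 : (8 : ℝ) ≤ Real.exp ((7 / 2) * L) := by
    have h1 : (2 : ℝ) ≤ Real.exp 1 := by
      have := Real.add_one_le_exp (1 : ℝ); linarith
    calc (8 : ℝ) = 2 ^ 3 := by norm_num
      _ ≤ Real.exp 1 ^ 3 := by gcongr
      _ = Real.exp 3 := by rw [← Real.exp_nat_mul]; norm_num
      _ ≤ Real.exp ((7 / 2) * L) := Real.exp_le_exp.2 (by linarith)
  have hle : Real.exp (-(9 / 2) * L) ≤ η / 8 := by
    rw [le_div_iff₀ (by norm_num)]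
    calc Real.exp (-(9 / 2) * L) * 8 ≤ Real.exp (-(9 / 2) * L) * Real.exp ((7 / 2) * L) := by gcongr
      _ = Real.exp (-L) := by rw [← Real.exp_add]; ring_nf
      _ = η := hηL
  have hfin : (Measure.pi fun _ : Fin n => P).real
      {x | ε ≤ F x - ∫ y, F y ∂(Measure.pi fun _ => P)} ≤ η / 8 :=
    hmain.trans ((le_of_eq (congrArg Real.exp hexp)).trans hle)
  refine (measure_mono fun x hx => ?_).trans
    ((ENNReal.le_ofReal_iff_toReal_le (measure_ne_top _ _) (by linarith [hη.1])).2 hfin)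
  simp only [mem_ofPred_eq] at hx ⊢
  have h1 : B / √n ≤ B * √L / √n := by
    gcongr
    nlinarith [Real.one_le_sqrt.2 hL1]
  have h2 : 7 * B * √L / √n = ε + B * √L / √n := by rw [hε]; ring
  change 7 * B * √L / √n < F x at hx
  linarith

end Hilbert

end Concentration

/-! ### Tikhonov regularization -/

section Resolvent

variable {H : Type*} [NormedAddCommGroup H] [InnerProductSpace ℝ H]

/-- Weighted AM-GM for `σ` and `lam`. It is applied with `s = θ - 1`, so `s ≤ 1` is the saturation
condition `θ ≤ 2`. -/
theorem mul_rpow_le_rpow_mul_add {s lam σ : ℝ} (hs0 : 0 ≤ s) (hs1 : s ≤ 1) (hlam : 0 < lam)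
    (hσ : 0 ≤ σ) : lam * σ ^ s ≤ lam ^ s * (σ + lam) := by
  have h := Real.geom_mean_le_arith_mean2_weighted hs0 (sub_nonneg.2 hs1) hσ hlam.le (by ring)
  have h2 : lam = lam ^ s * lam ^ (1 - s) := by
    rw [← Real.rpow_add hlam]; simp
  calc lam * σ ^ s = lam ^ s * (σ ^ s * lam ^ (1 - s)) := by
        conv_lhs => rw [h2]
        ring
    _ ≤ lam ^ s * (s * σ + (1 - s) * lam) := by gcongr
    _ ≤ lam ^ s * (σ + lam) := by
        gcongr
        · nlinarith
        · nlinarith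

theorem inner_diagonal {ι : Type*} (e : HilbertBasis ι ℝ H) {T : H →L[ℝ] H} {τ : ι → ℝ}
    (hT : ∀ i, T (e i) = τ i • e i) (i : ι) (g : H) :
    inner ℝ (e i) (T g) = τ i * inner ℝ (e i) g := by
  have h1 := ((e.hasSum_repr g).mapL T).mapL (innerSL ℝ (e i))
  refine h1.unique ?_
  have h2 : τ i * inner ℝ (e i) g = innerSL ℝ (e i) (T (e.repr g i • e i)) := by
    rw [map_smul, hT, map_smul, map_smul, innerSL_apply_apply, real_inner_self_eq_norm_sq,
      e.orthonormal.1 i, e.repr_apply_apply]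
    simp [mul_comm]
  rw [h2]
  refine hasSum_single i fun j hj => ?_
  rw [map_smul, hT, map_smul, map_smul, innerSL_apply_apply, e.orthonormal.2 hj.symm]
  simp

/-- Parseval, compared coordinate by coordinate. -/
theorem norm_le_mul_norm_of_abs_inner_le {ι : Type*} (e : HilbertBasis ι ℝ H) {x y : H} {a : ℝ}
    (ha : 0 ≤ a) (h : ∀ i, |(inner ℝ (e i) x : ℝ)| ≤ a * |inner ℝ (e i) y|) :
    ‖x‖ ≤ a * ‖y‖ := by
  have hx := e.hasSum_inner_mul_inner x x
  have hy := (e.hasSum_inner_mul_inner y y).mul_left (a ^ 2)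
  rw [real_inner_self_eq_norm_sq] at hx hy
  have hle : ‖x‖ ^ 2 ≤ a ^ 2 * ‖y‖ ^ 2 := by
    refine hasSum_le (fun i => ?_) hx hy
    rw [real_inner_comm, real_inner_comm (e i) y, ← sq, ← sq, ← mul_pow]
    refine sq_le_sq.2 ?_
    rw [abs_mul, abs_of_nonneg ha]
    exact h i
  rw [← mul_pow] at hle
  exact (sq_le_sq₀ (norm_nonneg _) (by positivity)).1 hle

/-- Coercivity: the quadratic form of `lam + S` is at least `lam ‖x‖ ^ 2`. -/
theorem exists_resolvent [CompleteSpace H] {S : H →L[ℝ] H} (hpos : ∀ x, 0 ≤ (inner ℝ (S x) x : ℝ)) {lam : ℝ}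
    (hlam : 0 < lam) (y : H) : ∃ x : H, lam • x + S x = y := by
  have hu : IsUnit (lam • ContinuousLinearMap.id ℝ H + S) := by
    refine ContinuousLinearMap.isUnit_of_forall_le_norm_inner_map _ (c := ⟨lam, hlam.le⟩)
      (by exact_mod_cast hlam) fun x => ?_
    have h1 : (inner ℝ ((lam • ContinuousLinearMap.id ℝ H + S) x) x : ℝ)
        = lam * ‖x‖ ^ 2 + inner ℝ (S x) x := by
      simp [inner_add_left, inner_smul_left]
    rw [h1]
    refine le_trans ?_ (le_abs_self _)
    have := hpos x
    change ‖x‖ ^ 2 * lam ≤ _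
    linarith
  obtain ⟨x, hx⟩ := (ContinuousLinearMap.isUnit_iff_bijective.1 hu).2 y
  exact ⟨x, by simpa using hx⟩

/-- Bias of the Tikhonov regularization under a source condition. -/
theorem norm_sub_le_of_source {S T : H →L[ℝ] H} {θ : ℝ} (hθ : θ ∈ Ioc (1 : ℝ) 2)
    (hST : IsPower S T θ) {h g x : H} (hg : T g = S h)
    (hker : ∀ v, S v = 0 → inner ℝ v h = (0 : ℝ)) {lam : ℝ} (hlam : 0 < lam)
    (hx : lam • x + S x = S h) : ‖x - h‖ ≤ lam ^ (θ - 1) * ‖g‖ := by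
  obtain ⟨s, e, σ, hσ⟩ := hST
  have hS := inner_diagonal e fun i => (hσ i).2.1
  have hT := inner_diagonal e fun i => (hσ i).2.2
  refine norm_le_mul_norm_of_abs_inner_le e (by positivity) fun i => ?_
  obtain ⟨h0, hSe, -⟩ := hσ i
  have h1 : (σ i + lam) * inner ℝ (e i) (x - h) = -(lam * inner ℝ (e i) h) := by
    have := congrArg (fun w => (inner ℝ (e i) w : ℝ)) hx
    simp only [inner_add_right, inner_smul_right, hS] at this
    rw [inner_sub_right]
    linarith
  have h2 : |(inner ℝ (e i) h : ℝ)| ≤ σ i ^ (θ - 1) * |inner ℝ (e i) g| := by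
    -- On the kernel of `S` the source equation `S h = T g` says nothing about `h`, hence the
    -- orthogonality hypothesis; elsewhere one factor `σ i` cancels.
    rcases h0.eq_or_lt with h0 | h0
    · rw [hker (e i) (by rw [hSe, ← h0, zero_smul])]
      rw [abs_zero]; positivity
    · have := hT i g
      rw [hg, hS, show θ = 1 + (θ - 1) by ring, Real.rpow_add h0, Real.rpow_one, mul_assoc] at this
      rw [mul_left_cancel₀ h0.ne' this, abs_mul, abs_of_nonneg (by positivity)]
  have hpos : 0 < σ i + lam := by linarith
  refine le_of_mul_le_mul_left ?_ hpos
  calc (σ i + lam) * |(inner ℝ (e i) (x - h) : ℝ)| = lam * |inner ℝ (e i) h| := by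
        have := congrArg abs h1
        rwa [abs_mul, abs_of_pos hpos, abs_neg, abs_mul, abs_of_pos hlam] at this
    _ ≤ lam * (σ i ^ (θ - 1) * |inner ℝ (e i) g|) := by gcongr
    _ = (lam * σ i ^ (θ - 1)) * |inner ℝ (e i) g| := by ring
    _ ≤ (lam ^ (θ - 1) * (σ i + lam)) * |inner ℝ (e i) g| := by
        refine mul_le_mul_of_nonneg_right ?_ (abs_nonneg _)
        exact mul_rpow_le_rpow_mul_add (sub_nonneg.2 hθ.1.le)
          (by linarith [hθ.2] : θ - 1 ≤ 1) hlam h0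
    _ = (σ i + lam) * (lam ^ (θ - 1) * |inner ℝ (e i) g|) := by ring

/-- The residual `h - x` satisfies `(lam + S)(h - x) = lam h`; pairing it with itself gives `‖h - x‖
≤ ‖h‖`. The bound does not depend on `lam`, which keeps the concentration constants free of the
sample sizes. -/
theorem norm_le_of_resolvent {S : H →L[ℝ] H} (hpos : ∀ x, 0 ≤ (inner ℝ (S x) x : ℝ)) {lam : ℝ}
    (hlam : 0 < lam) {x h : H} (hx : lam • x + S x = S h) : ‖x‖ ≤ 2 * ‖h‖ := by
  have h1 : lam • (h - x) + S (h - x) = lam • h := by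
    rw [smul_sub, map_sub, ← hx]; abel
  have h2 := congrArg (fun w => (inner ℝ w (h - x) : ℝ)) h1
  simp only [inner_add_left, inner_smul_left, real_inner_self_eq_norm_sq, RCLike.conj_to_real] at h2
  have h3 := hpos (h - x)
  have h4 : ‖h - x‖ ^ 2 ≤ ‖h‖ * ‖h - x‖ := by
    refine le_of_mul_le_mul_left ?_ hlam
    calc lam * ‖h - x‖ ^ 2 ≤ lam * inner ℝ h (h - x) := by linarith
      _ ≤ _ := by gcongr; exact real_inner_le_norm _ _
  have h5 : ‖h - x‖ ≤ ‖h‖ := by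
    rcases (norm_nonneg (h - x)).eq_or_lt with h0 | h0
    · rw [← h0]; positivity
    · exact le_of_mul_le_mul_right (by rwa [← sq]) h0
  calc ‖x‖ = ‖h - (h - x)‖ := by congr 1; abel
    _ ≤ ‖h‖ + ‖h - x‖ := norm_sub_le _ _
    _ ≤ 2 * ‖h‖ := by linarith

end Resolvent

/-! ### The estimator as a solution of an empirical equation -/

section Estimator

variable {Z : Type*} {H : Type*} [NormedAddCommGroup H] [InnerProductSpace ℝ H]
  [CompleteSpace H] [RKHS ℝ H Z ℝ]

theorem norm_feature_le {K : ℝ} (hK : ∀ x y : Z, |ker H x y| ≤ K) (x : Z) :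
    ‖feature H x‖ ≤ √K := by
  refine Real.le_sqrt_of_sq_le ?_
  rw [← real_inner_self_eq_norm_sq, inner_feature_feature]
  exact (le_abs_self _).trans (hK x x)

variable (H) in
/-- The empirical mean embedding. -/
def empMean {m : ℕ} (x : Fin m → Z) : H := (1 / (m : ℝ)) • ∑ i, feature H (x i)

theorem coe_sum {ι : Type*} (s : Finset ι) (f : ι → H) (u : Z) :
    (∑ i ∈ s, f i) u = ∑ i ∈ s, f i u := by
  rw [← inner_feature, sum_inner]
  simp only [inner_feature]

theorem empMean_apply {m : ℕ} (x : Fin m → Z) (u : Z) :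
    empMean H x u = 1 / (m : ℝ) * ∑ i, ker H u (x i) := by
  rw [empMean, RKHS.coe_smul, Pi.smul_apply, coe_sum, smul_eq_mul]
  simp only [feature_apply]

theorem isUnit_det_regGram {n : ℕ} (hn : 0 < n) {lam : ℝ} (hlam : 0 < lam) (y : Fin n → Z) :
    IsUnit (regGram H lam y).det := by
  have hn' : (0 : ℝ) < n := Nat.cast_pos.2 hn
  have h1 : gram H y y = Matrix.gram ℝ fun i => feature H (y i) := by
    ext i j
    simp [gram, Matrix.gram_apply, inner_feature_feature]
  have h2 : (regGram H lam y).PosDef := by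
    rw [regGram, h1]
    exact (Matrix.PosDef.one.smul (by positivity)).add_posSemidef (Matrix.posSemidef_gram ..)
  exact h2.det_pos.ne'.isUnit

open Matrix in
/-- Up to the constant `1`, the estimated ratio is the solution of the regularized empirical
equation. -/
theorem exists_ratioEst_eq {m n : ℕ} (hn : 0 < n) {lam : ℝ} (hlam : 0 < lam)
    (x : Fin m → Z) (y : Fin n → Z) :
    ∃ v : H, (∀ u, ratioEst H lam x y u = v u + 1) ∧
      lam • v + (1 / (n : ℝ)) • ∑ i, v (y i) • feature H (y i) = empMean H x - empMean H y := by
  have hn' : (0 : ℝ) < n := Nat.cast_pos.2 hn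
  set w : H := empMean H x - empMean H y with hw
  set L := regGram H lam y with hL
  -- Dual coefficients: the solution is `lam⁻¹ (w - ∑ β_i φ(y_i))`, and row `i` of `L β = w(y)` says
  -- that its value at `y i` is `n β_i`.
  set β : Fin n → ℝ := L⁻¹ *ᵥ fun i => w (y i) with hβ
  have hwu : ∀ u, w u = 1 / (m : ℝ) * ∑ i, ker H u (x i) - 1 / (n : ℝ) * ∑ i, ker H u (y i) :=
    fun u => by rw [hw, RKHS.coe_sub, Pi.sub_apply, empMean_apply, empMean_apply]
  have hβ' : β = (1 / (m : ℝ)) • (L⁻¹ *ᵥ (gram H y x *ᵥ 1))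
      - (1 / (n : ℝ)) • (L⁻¹ *ᵥ (gram H y y *ᵥ 1)) := by
    have h1 : (fun i => w (y i))
        = (1 / (m : ℝ)) • (gram H y x *ᵥ 1) - (1 / (n : ℝ)) • (gram H y y *ᵥ 1) := by
      ext i
      simp [hwu, gram, mulVec, dotProduct]
    rw [hβ, h1, mulVec_sub, mulVec_smul, mulVec_smul]
  have hLβ : L *ᵥ β = fun i => w (y i) := by
    rw [hβ, mulVec_mulVec, mul_nonsing_inv _ (isUnit_det_regGram hn hlam y), one_mulVec]
  have hsum : ∀ u, (∑ i, β i • feature H (y i)) u = kvec H u y ⬝ᵥ β := fun u => by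
    rw [coe_sum, dotProduct]
    refine Finset.sum_congr rfl fun i _ => ?_
    rw [RKHS.coe_smul, Pi.smul_apply, smul_eq_mul, feature_apply, kvec, mul_comm]
  have hvu : ∀ u, (lam⁻¹ • (w - ∑ i, β i • feature H (y i))) u
      = lam⁻¹ * (w u - kvec H u y ⬝ᵥ β) := fun u => by
    rw [RKHS.coe_smul, Pi.smul_apply, RKHS.coe_sub, Pi.sub_apply, hsum, smul_eq_mul]
  refine ⟨lam⁻¹ • (w - ∑ i, β i • feature H (y i)), fun u => ?_, ?_⟩
  · rw [hvu, hwu, hβ', dotProduct_sub, dotProduct_smul, dotProduct_smul, ratioEst]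
    simp only [dotProduct_one, smul_eq_mul, one_div, mul_inv]
    simp only [kvec]
    ring
  · have hvy : ∀ i, (lam⁻¹ • (w - ∑ i, β i • feature H (y i))) (y i) = n * β i := fun i => by
      rw [hvu]
      have h1 := congrFun hLβ i
      rw [hL, regGram, add_mulVec, smul_mulVec, one_mulVec] at h1
      have h2 : kvec H (y i) y ⬝ᵥ β = (gram H y y *ᵥ β) i := rfl
      rw [h2, ← h1]
      simp
      field_simp
    simp only [hvy, mul_smul, ← Finset.smul_sum]
    rw [smul_smul, smul_smul, mul_inv_cancel₀ hlam.ne', one_div, inv_mul_cancel₀ hn'.ne', one_smul,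
      one_smul, sub_add_cancel]

/-- Pair the equation with `d`: the empirical covariance contributes the average of `d(y i) ^ 2`,
which is nonnegative. -/
theorem mul_norm_le_of_empirical {n : ℕ} {lam : ℝ} (y : Fin n → Z) {d w : H}
    (h : lam • d + (1 / (n : ℝ)) • ∑ i, d (y i) • feature H (y i) = w) :
    lam * ‖d‖ ≤ ‖w‖ := by
  have h2 := congrArg (fun v => (inner ℝ v d : ℝ)) h
  simp only [inner_add_left, inner_smul_left, real_inner_self_eq_norm_sq, RCLike.conj_to_real,
    sum_inner] at h2
  have h3 : 0 ≤ 1 / (n : ℝ) * ∑ i, d (y i) * inner ℝ (feature H (y i)) d := by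
    refine mul_nonneg (by positivity) (Finset.sum_nonneg fun i _ => ?_)
    rw [real_inner_comm, inner_feature]
    exact mul_self_nonneg _
  rcases (norm_nonneg d).eq_or_lt with h0 | h0
  · rw [← h0]; simp
  · refine le_of_mul_le_mul_right ?_ h0
    have := real_inner_le_norm w d
    nlinarith

/-- Deterministic bound of the estimation error by two centered averages. -/
theorem norm_sub_le_add {m n : ℕ} {lam : ℝ} (x : Fin m → Z) (y : Fin n → Z)
    {S : H →L[ℝ] H} {p q h k v : H} (hpq : p - q = S h) (hk : lam • k + S k = S h)
    (hv : lam • v + (1 / (n : ℝ)) • ∑ i, v (y i) • feature H (y i) = empMean H x - empMean H y) :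
    lam * ‖v - k‖ ≤ ‖empMean H x - p‖
      + ‖(1 / (n : ℝ)) • ∑ i, (1 + k (y i)) • feature H (y i) - (q + S k)‖ := by
  -- The error `v - k` solves the empirical equation with this right side. The empirical covariance
  -- is compared with `S` only at the fixed vector `k`, so no operator-norm concentration is needed.
  refine (mul_norm_le_of_empirical y (w := (empMean H x - p)
      - ((1 / (n : ℝ)) • ∑ i, (1 + k (y i)) • feature H (y i) - (q + S k))) ?_).trans
    (norm_sub_le _ _)
  simp only [RKHS.coe_sub, Pi.sub_apply, sub_smul, add_smul, one_smul, Finset.sum_sub_distrib,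
    Finset.sum_add_distrib, smul_sub, smul_add]
  have h1 : p = S h + q := by rw [← hpq]; abel
  rw [h1, ← hk, ← empMean]
  have h2 : lam • v = empMean H x - empMean H y
      - (1 / (n : ℝ)) • ∑ i, v (y i) • feature H (y i) := by rw [← hv]; abel
  rw [h2]
  abel

end Estimator

/-! ### Density ratio and source condition -/

section Source

variable {Z : Type*} [MeasurableSpace Z] {H : Type*} [NormedAddCommGroup H]
  [InnerProductSpace ℝ H] [CompleteSpace H] [RKHS ℝ H Z ℝ]

theorem meanEmbedding_sub_eq (hk : Measurable fun p : Z × Z => ker H p.1 p.2) {K : ℝ}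
    (hK : ∀ x y : Z, |ker H x y| ≤ K) {P Q : Measure Z} [IsProbabilityMeasure P]
    [IsProbabilityMeasure Q] (hPQ : P ≪ Q) {h : H} (hr : ∀ᵐ z ∂Q, ratio P Q z - 1 = h z) :
    meanEmbedding H P - meanEmbedding H Q = covOp H Q h := by
  refine ext_inner_left ℝ fun f => ?_
  rw [inner_sub_right, inner_meanEmbedding hk hK, inner_meanEmbedding hk hK, inner_covOp hk hK,
    ← integral_rnDeriv_smul hPQ, ← integral_sub]
  · refine integral_congr_ae ?_
    filter_upwards [hr] with z hz
    rw [← hz, ratio, smul_eq_mul]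
    ring
  · exact (integrable_rnDeriv_smul_iff hPQ).2 (integrable_coe hk hK P f)
  · exact integrable_coe hk hK Q f

theorem inner_covOp_self_nonneg (hk : Measurable fun p : Z × Z => ker H p.1 p.2) {K : ℝ}
    (hK : ∀ x y : Z, |ker H x y| ≤ K) (Q : Measure Z) [IsProbabilityMeasure Q] (f : H) :
    0 ≤ (inner ℝ (covOp H Q f) f : ℝ) := by
  rw [real_inner_comm, inner_covOp hk hK]
  exact integral_nonneg fun z => mul_self_nonneg _

/-- The quadratic form of the covariance at `f` is `∫ f ^ 2 dQ`. Hence removing the kernel component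
of an element changes it only on a `Q`-null set. -/
theorem ae_eq_zero_of_covOp_eq_zero (hk : Measurable fun p : Z × Z => ker H p.1 p.2) {K : ℝ}
    (hK : ∀ x y : Z, |ker H x y| ≤ K) (Q : Measure Z) [IsProbabilityMeasure Q] {f : H}
    (hf : covOp H Q f = 0) : ∀ᵐ z ∂Q, f z = 0 := by
  have h1 := inner_covOp hk hK Q f f
  rw [hf, inner_zero_right] at h1
  have h2 := (integral_eq_zero_iff_of_nonneg (fun z => mul_self_nonneg (f z))
    (integrable_coe_mul hk hK Q f f)).1 h1.symm
  filter_upwards [h2] with z hz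
  simpa using hz

/-- Regularized approximations of the centered density ratio under the source condition. -/
theorem exists_regularization (hk : Measurable fun p : Z × Z => ker H p.1 p.2) {K : ℝ}
    (hK : ∀ x y : Z, |ker H x y| ≤ K) {P Q : Measure Z} [IsProbabilityMeasure P]
    [IsProbabilityMeasure Q] (hPQ : P ≪ Q)
    (hr : ∃ h : H, ∀ᵐ z ∂Q, ratio P Q z - 1 = h z) {θ : ℝ} (hθ : θ ∈ Ioc (1 : ℝ) 2)
    (hsrc : meanEmbedding H P - meanEmbedding H Q ∈ powRange (covOp H Q) θ) :
    ∃ h : H, ∃ D : ℝ, 0 ≤ D ∧ (∀ᵐ z ∂Q, ratio P Q z - 1 = h z) ∧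
      meanEmbedding H P - meanEmbedding H Q = covOp H Q h ∧
      ∀ lam : ℝ, 0 < lam → ∃ k : H, lam • k + covOp H Q k = covOp H Q h ∧
        ‖k - h‖ ≤ lam ^ (θ - 1) * D ∧ ‖k‖ ≤ 2 * ‖h‖ := by
  obtain ⟨h₀, hh₀⟩ := hr
  set S := covOp H Q with hS
  -- The given representative may have a component in the kernel of `S`, which regularization cannot
  -- recover; its projection `h` represents the same ratio.
  obtain ⟨a, ha, h, hh, rfl⟩ := (LinearMap.ker (S : H →ₗ[ℝ] H)).exists_add_mem_mem_orthogonal h₀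
  have ha : S a = 0 := ha
  have hrh : ∀ᵐ z ∂Q, ratio P Q z - 1 = h z := by
    filter_upwards [hh₀, ae_eq_zero_of_covOp_eq_zero hk hK Q ha] with z h1 h2
    rw [h1, RKHS.coe_add, Pi.add_apply, h2, zero_add]
  have hdiff := meanEmbedding_sub_eq hk hK hPQ hrh
  obtain ⟨T, hT, g, hg⟩ := hsrc
  have hpos := inner_covOp_self_nonneg (H := H) hk hK Q
  refine ⟨h, ‖g‖, norm_nonneg _, hrh, hdiff, fun lam hlam => ?_⟩
  obtain ⟨k, hk'⟩ := exists_resolvent hpos hlam (S h)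
  refine ⟨k, hk', ?_, norm_le_of_resolvent hpos hlam hk'⟩
  refine norm_sub_le_of_source hθ hT (hg.trans hdiff) (fun v hv => ?_) hlam hk'
  exact (Submodule.mem_orthogonal _ _).1 hh v hv

end Source

/-! ### Measurability of the estimated ratio -/

section Measurability

theorem measurable_det {Ω : Type*} [MeasurableSpace Ω] {n : ℕ}
    {M : Ω → Matrix (Fin n) (Fin n) ℝ} (hM : ∀ i j, Measurable fun ω => M ω i j) :
    Measurable fun ω => (M ω).det := by
  simp only [Matrix.det_apply]
  refine Finset.measurable_sum _ fun σ _ => Measurable.const_smul ?_ _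
  exact Finset.measurable_prod _ fun i _ => hM _ _

/-- Cramer's rule. Inversion in `ℝ` is measurable with value `0` at `0`, so no invertibility is
required. -/
theorem measurable_inv_apply {Ω : Type*} [MeasurableSpace Ω] {n : ℕ}
    {M : Ω → Matrix (Fin n) (Fin n) ℝ} (hM : ∀ i j, Measurable fun ω => M ω i j)
    (i j : Fin n) : Measurable fun ω => (M ω)⁻¹ i j := by
  simp only [Matrix.inv_def, Matrix.smul_apply, Matrix.adjugate_apply, Ring.inverse_eq_inv',
    smul_eq_mul]
  refine (measurable_det hM).inv.mul (measurable_det fun a b => ?_)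
  simp only [Matrix.updateRow_apply]
  split_ifs
  · exact measurable_const
  · exact hM a b

variable {Z : Type*} [MeasurableSpace Z] {H : Type*} [NormedAddCommGroup H]
  [InnerProductSpace ℝ H] [CompleteSpace H] [RKHS ℝ H Z ℝ]

theorem measurable_comp₂ {Ω : Type*} [MeasurableSpace Ω] {k : Z → Z → ℝ}
    (hk : Measurable fun p : Z × Z => k p.1 p.2) {f g : Ω → Z} (hf : Measurable f)
    (hg : Measurable g) : Measurable fun ω => k (f ω) (g ω) := by
  have h : Measurable fun ω => (f ω, g ω) := hf.prodMk hg
  exact hk.comp h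

/-- Needed to evaluate the push-forward `ratioEstLaw` on intervals. -/
theorem measurable_ratioEst (hk : Measurable fun p : Z × Z => ker H p.1 p.2) (m n : ℕ)
    (lam : ℝ) : Measurable fun p : (Fin m → Z) × (Fin n → Z) × Z =>
      ratioEst H lam p.1 p.2.1 p.2.2 := by
  have hx : ∀ i, Measurable fun p : (Fin m → Z) × (Fin n → Z) × Z => p.1 i := fun i => by
    fun_prop
  have hy : ∀ i, Measurable fun p : (Fin m → Z) × (Fin n → Z) × Z => p.2.1 i := fun i => by
    fun_prop
  have hu : Measurable fun p : (Fin m → Z) × (Fin n → Z) × Z => p.2.2 :=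
    measurable_snd.comp measurable_snd
  have hux : ∀ i, Measurable fun p : (Fin m → Z) × (Fin n → Z) × Z => kvec H p.2.2 p.1 i :=
    fun i => measurable_comp₂ (k := ker H) hk hu (hx i)
  have huy : ∀ i, Measurable fun p : (Fin m → Z) × (Fin n → Z) × Z => kvec H p.2.2 p.2.1 i :=
    fun i => measurable_comp₂ (k := ker H) hk hu (hy i)
  have hyx : ∀ i j, Measurable fun p : (Fin m → Z) × (Fin n → Z) × Z => gram H p.2.1 p.1 i j :=
    fun i j => measurable_comp₂ (k := ker H) hk (hy i) (hx j)
  have hyy : ∀ i j, Measurable fun p : (Fin m → Z) × (Fin n → Z) × Z =>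
      gram H p.2.1 p.2.1 i j := fun i j => measurable_comp₂ (k := ker H) hk (hy i) (hy j)
  have hinv : ∀ i j, Measurable fun p : (Fin m → Z) × (Fin n → Z) × Z =>
      (regGram H lam p.2.1)⁻¹ i j := by
    refine measurable_inv_apply fun i j => ?_
    simp only [regGram, Matrix.add_apply]
    exact (hyy i j).const_add _
  have hdot : ∀ {l : ℕ} (a b : (Fin m → Z) × (Fin n → Z) × Z → Fin l → ℝ),
      (∀ i, Measurable fun p => a p i) → (∀ i, Measurable fun p => b p i) →
      Measurable fun p => a p ⬝ᵥ b p := fun a b ha hb =>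
    Finset.measurable_sum _ fun i _ => (ha i).mul (hb i)
  have hone : ∀ {l : ℕ} (i : Fin l), Measurable fun _ : (Fin m → Z) × (Fin n → Z) × Z =>
      (1 : Fin l → ℝ) i := fun i => measurable_const
  have h1 := hdot _ _ hux hone
  have h2 := hdot _ _ huy hone
  have h3 := hdot _ _ huy fun i => hdot _ _ (hinv i) fun j => hdot _ _ (hyx j) hone
  have h4 := hdot _ _ huy fun i => hdot _ _ (hinv i) fun j => hdot _ _ (hyy j) hone
  exact ((((h1.const_mul _).sub (h2.const_mul _)).sub (h3.const_mul _)).add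
    (h4.const_mul _)).add_const _

end Measurability

/-! ### Uniform error of the estimated ratio -/

section Uniform

theorem one_le_log_one_div {η : ℝ} (hη : η ∈ Ioo 0 (Real.exp (-1))) :
    1 ≤ Real.log (1 / η) := by
  rw [one_div, Real.log_inv]
  have := Real.log_lt_log hη.1 hη.2
  rw [Real.log_exp] at this
  linarith

theorem one_le_sqrt_log {η : ℝ} (hη : η ∈ Ioo 0 (Real.exp (-1))) :
    1 ≤ √(Real.log (1 / η)) :=
  Real.one_le_sqrt.2 (one_le_log_one_div hη)

theorem one_div_sqrt_le_rpow_min {m n l : ℕ} (hm : 1 ≤ m) (hn : 1 ≤ n) (hl : min m n ≤ l) :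
    1 / √(l : ℝ) ≤ ((min m n : ℕ) : ℝ) ^ (-(1 / 2) : ℝ) := by
  have h1 : (0 : ℝ) < (min m n : ℕ) := Nat.cast_pos.2 (by omega)
  rw [Real.rpow_neg h1.le, ← Real.sqrt_eq_rpow, one_div]
  have := Real.sqrt_pos.2 h1
  gcongr

theorem regParam_pos {θ : ℝ} {m n : ℕ} (hm : 1 ≤ m) (hn : 1 ≤ n) : 0 < regParam θ m n :=
  Real.rpow_pos_of_pos (Nat.cast_pos.2 (by omega)) _

theorem rate_pos {θ : ℝ} {m n : ℕ} (hm : 1 ≤ m) (hn : 1 ≤ n) : 0 < rate θ m n :=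
  Real.rpow_pos_of_pos (Nat.cast_pos.2 (by omega)) _

theorem regParam_rpow {θ : ℝ} {m n : ℕ} : regParam θ m n ^ (θ - 1) = rate θ m n := by
  rw [regParam, rate, ← Real.rpow_mul (Nat.cast_nonneg _)]
  congr 1
  ring

/-- The right side is `N ^ (-θ / (2 (θ + 1)))`: the stochastic error, after division by `lam`, stays
below the bias. -/
theorem rpow_min_le_regParam_mul_rate {θ : ℝ} (hθ : 1 < θ) {m n : ℕ} (hm : 1 ≤ m) (hn : 1 ≤ n) :
    ((min m n : ℕ) : ℝ) ^ (-(1 / 2) : ℝ) ≤ regParam θ m n * rate θ m n := by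
  have h1 : (1 : ℝ) ≤ (min m n : ℕ) := Nat.one_le_cast.2 (by omega)
  rw [regParam, rate, ← Real.rpow_add (by linarith)]
  refine Real.rpow_le_rpow_of_exponent_le h1 ?_
  rw [← add_div, neg_le, ← neg_div, div_le_div_iff₀ (by linarith) (by norm_num)]
  nlinarith

variable {Z : Type*} [MeasurableSpace Z] {H : Type*} [NormedAddCommGroup H]
  [InnerProductSpace ℝ H] [CompleteSpace H] [RKHS ℝ H Z ℝ]

/-- Concentration of a weighted empirical mean embedding. -/
theorem measure_norm_weighted_sub_gt_le (hk : Measurable fun p : Z × Z => ker H p.1 p.2) {K : ℝ}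
    (hK : ∀ x y : Z, |ker H x y| ≤ K) (P : Measure Z) [IsProbabilityMeasure P] {a : Z → ℝ}
    (ha : Measurable a) {A R : ℝ} (hA : ∀ z, |a z| ≤ A) {q : H} (hR : ‖q‖ ≤ R)
    (hq : ∀ v : H, inner ℝ v q = ∫ z, a z * v z ∂P) {n : ℕ} (hn : 0 < n) {η : ℝ}
    (hη : η ∈ Ioo 0 (Real.exp (-1))) :
    (Measure.pi fun _ : Fin n => P)
      {x | 7 * (A * √K + R) * √(Real.log (1 / η)) / √n
        < ‖(1 / (n : ℝ)) • ∑ i, a (x i) • feature H (x i) - q‖} ≤ ENNReal.ofReal (η / 8) := by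
  have hn' : (0 : ℝ) < n := Nat.cast_pos.2 hn
  have heq : ∀ x : Fin n → Z, (1 / (n : ℝ)) • ∑ i, a (x i) • feature H (x i) - q
      = (1 / (n : ℝ)) • ∑ i, (a (x i) • feature H (x i) - q) := fun x => by
    rw [Finset.sum_sub_distrib, smul_sub, Finset.sum_const, Finset.card_univ, Fintype.card_fin,
      ← Nat.cast_smul_eq_nsmul ℝ, smul_smul, one_div, inv_mul_cancel₀ hn'.ne', one_smul]
  simp only [heq]
  refine measure_norm_average_gt_le P (ζ := fun z => a z • feature H z - q) hn (fun z => ?_) ?_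
    (fun v => ?_) hη
  · refine (norm_sub_le _ _).trans (add_le_add ?_ hR)
    rw [norm_smul]
    exact mul_le_mul (hA z) (norm_feature_le hK z) (norm_nonneg _) ((abs_nonneg _).trans (hA z))
  · have h1 : (fun p : Z × Z => (inner ℝ (a p.1 • feature H p.1 - q)
        (a p.2 • feature H p.2 - q) : ℝ)) = fun p => a p.1 * (a p.2 * ker H p.1 p.2)
          - a p.1 * q p.1 - (a p.2 * q p.2 - inner ℝ q q) := by
      ext p
      simp only [inner_sub_left, inner_sub_right, inner_smul_left, inner_smul_right,
        inner_feature_feature, RCLike.conj_to_real]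
      rw [real_inner_comm q, inner_feature, real_inner_comm q, inner_feature]
      ring
    rw [h1]
    have hq := measurable_coe hk q
    have ha1 := ha.comp (measurable_fst : Measurable (Prod.fst : Z × Z → Z))
    have ha2 := ha.comp (measurable_snd : Measurable (Prod.snd : Z × Z → Z))
    have hq1 := hq.comp (measurable_fst : Measurable (Prod.fst : Z × Z → Z))
    have hq2 := hq.comp (measurable_snd : Measurable (Prod.snd : Z × Z → Z))
    exact ((ha1.mul (ha2.mul hk)).sub (ha1.mul hq1)).sub ((ha2.mul hq2).sub_const _)
  · simp only [inner_sub_right, inner_smul_right, inner_feature]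
    rw [integral_sub _ (integrable_const _), ← hq]
    · simp
    · exact (integrable_coe hk hK P v).bdd_mul ha.aestronglyMeasurable
        (Filter.Eventually.of_forall hA)

/-- The estimated density ratio is uniformly close to the density ratio, except on an event of
small probability. -/
theorem exists_uniform_bound (hk : Measurable fun p : Z × Z => ker H p.1 p.2) {K : ℝ}
    (hK : ∀ x y : Z, |ker H x y| ≤ K) {P Q : Measure Z} [IsProbabilityMeasure P]
    [IsProbabilityMeasure Q] (hPQ : P ≪ Q)
    (hr : ∃ h : H, ∀ᵐ z ∂Q, ratio P Q z - 1 = h z) {θ : ℝ} (hθ : θ ∈ Ioc (1 : ℝ) 2)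
    (hsrc : meanEmbedding H P - meanEmbedding H Q ∈ powRange (covOp H Q) θ) :
    ∃ h : H, ∃ C₀ : ℝ, 0 < C₀ ∧ (∀ᵐ z ∂Q, ratio P Q z = h z + 1) ∧
      ∀ m n : ℕ, 1 ≤ m → 1 ≤ n → ∀ η ∈ Ioo (0 : ℝ) (Real.exp (-1)),
      ∃ (U : Set (Fin m → Z)) (V : Set (Fin n → Z)),
        (Measure.pi fun _ => P) U ≤ ENNReal.ofReal (η / 8) ∧
        (Measure.pi fun _ => Q) V ≤ ENNReal.ofReal (η / 8) ∧
        ∀ x ∉ U, ∀ y ∉ V, ∀ u, |ratioEst H (regParam θ m n) x y u - (h u + 1)|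
          ≤ C₀ * rate θ m n * √(Real.log (1 / η)) := by
  obtain ⟨h, D, hD, hrh, hdiff, hreg⟩ := exists_regularization hk hK hPQ hr hθ hsrc
  set S := covOp H Q with hS
  set p := meanEmbedding H P
  set q := meanEmbedding H Q
  set B₁ : ℝ := 1 * √K + ‖p‖
  set B₂ : ℝ := (1 + √K * (2 * ‖h‖)) * √K + (‖q‖ + ‖S‖ * (2 * ‖h‖))
  have hB₁ : 0 ≤ B₁ := by positivity
  have hB₂ : 0 ≤ B₂ := by positivity
  -- `√K` converts norms to uniform bounds, `7 (B₁ + B₂)` is the stochastic error and `D` the bias;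
  -- `+ 1` only ensures positivity.
  refine ⟨h, √K * (7 * (B₁ + B₂) + D) + 1, by positivity, ?_, fun m n hm hn η hη => ?_⟩
  · filter_upwards [hrh] with z hz
    linarith
  have hlam := regParam_pos (θ := θ) hm hn
  have hρ := rate_pos (θ := θ) hm hn
  have hL := one_le_sqrt_log hη
  set lam := regParam θ m n with hlamdef
  set ρ := rate θ m n
  set L := √(Real.log (1 / η))
  obtain ⟨k, hkS, hkh, hkn⟩ := hreg lam hlam
  have hkm := measurable_coe hk k
  have hU := measure_norm_weighted_sub_gt_le hk hK P (a := fun _ => 1) measurable_const (A := 1)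
    (by simp) (q := p) le_rfl (fun v => by simpa using inner_meanEmbedding hk hK P v) hm hη
  have hV := measure_norm_weighted_sub_gt_le hk hK Q (a := fun z => 1 + k z) (hkm.const_add 1)
    (A := 1 + √K * (2 * ‖h‖)) (R := ‖q‖ + ‖S‖ * (2 * ‖h‖))
    (fun z => (abs_add_le _ _).trans (add_le_add (by simp)
      ((abs_coe_le hK k z).trans (mul_le_mul_of_nonneg_left hkn (Real.sqrt_nonneg _)))))
    (q := q + S k) ((norm_add_le _ _).trans (add_le_add le_rfl ((S.le_opNorm k).trans
      (mul_le_mul_of_nonneg_left hkn (norm_nonneg S)))))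
    (fun v => by
      rw [inner_add_right, inner_meanEmbedding hk hK, inner_covOp hk hK,
        ← integral_add (integrable_coe hk hK Q v) (integrable_coe_mul hk hK Q v k)]
      refine integral_congr_ae (Filter.Eventually.of_forall fun z => ?_)
      simp only
      ring) hn hη
  refine ⟨_, _, hU, hV, fun x hx y hy u => ?_⟩
  simp only [mem_ofPred_eq, not_lt, one_smul] at hx hy
  obtain ⟨v, hvr, hv⟩ := exists_ratioEst_eq (H := H) hn hlam x y
  have hmain := norm_sub_le_add x y hdiff hkS hv
  have hN := rpow_min_le_regParam_mul_rate hθ.1 hm hn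
  have hbound : ∀ {l : ℕ} {B : ℝ}, 0 ≤ B → min m n ≤ l → 7 * B * L / √l ≤ 7 * B * L * (lam * ρ) :=
    fun {l B} hB hl => by
      rw [div_eq_mul_one_div]
      exact mul_le_mul_of_nonneg_left ((one_div_sqrt_le_rpow_min hm hn hl).trans hN) (by positivity)
  have h1 : ‖v - k‖ ≤ 7 * (B₁ + B₂) * (ρ * L) := by
    refine le_of_mul_le_mul_left (hmain.trans ?_) hlam
    have h2 := hx.trans (hbound hB₁ (min_le_left m n))
    have h3 := hy.trans (hbound hB₂ (min_le_right m n))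
    rw [empMean]
    calc _ ≤ 7 * B₁ * L * (lam * ρ) + 7 * B₂ * L * (lam * ρ) := add_le_add h2 h3
      _ = _ := by ring
  have h2 : ‖k - h‖ ≤ D * (ρ * L) := by
    refine hkh.trans ?_
    rw [hlamdef, regParam_rpow, mul_comm]
    refine mul_le_mul_of_nonneg_left ?_ hD
    exact le_mul_of_one_le_right hρ.le hL
  have h3 : ratioEst H lam x y u - (h u + 1) = (v - k + (k - h) : H) u := by
    rw [hvr, sub_add_sub_cancel, RKHS.coe_sub, Pi.sub_apply]
    ring
  have hρL : 0 ≤ ρ * L := by positivity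
  calc |ratioEst H lam x y u - (h u + 1)| ≤ √K * ‖v - k + (k - h)‖ := by
        rw [h3]; exact abs_coe_le hK _ u
    _ ≤ √K * (7 * (B₁ + B₂) * (ρ * L) + D * (ρ * L)) := by
        gcongr
        exact (norm_add_le _ _).trans (add_le_add h1 h2)
    _ ≤ (√K * (7 * (B₁ + B₂) + D) + 1) * ρ * L := by nlinarith

end Uniform

/-! ### Averages over the second samples -/

section Averages

theorem abs_average_sub_average_le {n : ℕ} {a b d : Fin n → ℝ} (h : ∀ i, |a i - b i| ≤ d i) :
    |1 / (n : ℝ) * ∑ i, a i - 1 / (n : ℝ) * ∑ i, b i| ≤ 1 / (n : ℝ) * ∑ i, d i := by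
  rw [← mul_sub, ← Finset.sum_sub_distrib, abs_mul, abs_of_nonneg (by positivity)]
  gcongr
  exact (Finset.abs_sum_le_sum_abs _ _).trans (Finset.sum_le_sum fun i _ => h i)

variable {Z : Type*} [MeasurableSpace Z]

theorem measure_abs_average_sub_gt_le (ν : Measure Z) [IsProbabilityMeasure ν] {g : Z → ℝ}
    (hg : Measurable g) {B : ℝ} (hB : ∀ z, |g z| ≤ B) {n : ℕ} (hn : 0 < n) {η : ℝ}
    (hη : η ∈ Ioo 0 (Real.exp (-1))) :
    (Measure.pi fun _ : Fin n => ν)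
      {x | 14 * B * √(Real.log (1 / η)) / √n < |1 / (n : ℝ) * ∑ i, g (x i) - ∫ z, g z ∂ν|}
      ≤ ENNReal.ofReal (η / 8) := by
  have hn' : (0 : ℝ) < n := Nat.cast_pos.2 hn
  have hgc : Measurable fun z => g z - ∫ w, g w ∂ν := hg.sub_const _
  have h := measure_norm_average_gt_le ν (ζ := fun z => g z - ∫ w, g w ∂ν) (B := B + B) hn
    (fun z => (abs_sub _ _).trans (add_le_add (hB z) (abs_integral_le_of_abs_le ν hB))) ?_
    (fun v => ?_) hη
  · refine (measure_mono fun x hx => ?_).trans h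
    simp only [mem_ofPred_eq] at hx ⊢
    rw [show 14 * B = 7 * (B + B) by ring] at hx
    refine hx.trans_eq ?_
    rw [Finset.sum_sub_distrib, Real.norm_eq_abs, smul_eq_mul, mul_sub]
    congr 2
    simp
    field_simp
  · simp only [RCLike.inner_apply, conj_trivial]
    exact (hgc.comp measurable_snd).mul (hgc.comp measurable_fst)
  · simp only [RCLike.inner_apply, conj_trivial]
    rw [integral_mul_const, integral_sub (integrable_of_measurable_of_abs_le ν hg hB)
      (integrable_const _)]
    simp

/-- Averages of functions which are close to a fixed function `G` at the sample points. -/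
theorem exists_average_sub_le (ν : Measure Z) [IsProbabilityMeasure ν] {G w : Z → ℝ}
    (hG : Measurable G) (hw : Measurable w) {B B' δ : ℝ} (hB : ∀ z, |G z| ≤ B)
    (hB' : ∀ z, |w z| ≤ B') (hδ : ∫ z, w z ∂ν ≤ δ) {p : Z → Prop} (hp : ∀ᵐ z ∂ν, p z) {n : ℕ}
    (hn : 0 < n) {η : ℝ} (hη : η ∈ Ioo 0 (Real.exp (-1))) :
    ∃ U : Set (Fin n → Z), (Measure.pi fun _ => ν) U ≤ ENNReal.ofReal (η / 4) ∧
      ∀ x ∉ U, (∀ i, p (x i)) ∧ ∀ F : Z → ℝ, (∀ i, |F (x i) - G (x i)| ≤ w (x i)) →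
        |1 / (n : ℝ) * ∑ i, F (x i) - ∫ z, G z ∂ν|
          ≤ δ + 14 * (B + B') * √(Real.log (1 / η)) / √n := by
  have hp' : ∀ᵐ x ∂(Measure.pi fun _ : Fin n => ν), ∀ i, p (x i) :=
    Filter.eventually_all.2 fun i =>
      (Measure.tendsto_eval_ae_ae (μ := fun _ : Fin n => ν) (i := i)).eventually hp
  have h1 := measure_abs_average_sub_gt_le ν hG hB hn hη
  have h2 := measure_abs_average_sub_gt_le ν hw hB' hn hη
  -- The exceptional set involves only `G`, `w` and `p`. As `F` is chosen afterwards, it may depend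
  -- on the first samples, without conditioning.
  refine ⟨{x | ¬ ∀ i, p (x i)}
    ∪ ({x | 14 * B * √(Real.log (1 / η)) / √n < |1 / (n : ℝ) * ∑ i, G (x i) - ∫ z, G z ∂ν|}
    ∪ {x | 14 * B' * √(Real.log (1 / η)) / √n < |1 / (n : ℝ) * ∑ i, w (x i) - ∫ z, w z ∂ν|}),
    ?_, fun x hx => ?_⟩
  · refine (measure_union_le _ _).trans ?_
    rw [ae_iff.1 hp', zero_add]
    refine (measure_union_le _ _).trans ((add_le_add h1 h2).trans_eq ?_)
    rw [← ENNReal.ofReal_add (by linarith [hη.1]) (by linarith [hη.1])]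
    congr 1
    ring
  · simp only [mem_union, mem_ofPred_eq, not_or, not_not, not_lt] at hx
    obtain ⟨hx0, hx1, hx2⟩ := hx
    refine ⟨hx0, fun F hF => ?_⟩
    have h3 := abs_average_sub_average_le hF
    have h4 := (abs_le.1 hx2).2
    have h5 := abs_sub_le (1 / (n : ℝ) * ∑ i, F (x i)) (1 / (n : ℝ) * ∑ i, G (x i))
      (∫ z, G z ∂ν)
    have h6 : 14 * (B + B') * √(Real.log (1 / η)) / √(n : ℝ)
        = 14 * B * √(Real.log (1 / η)) / √n + 14 * B' * √(Real.log (1 / η)) / √n := by ring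
    linarith

/-- Change of measure in the equality case of Fenchel-Young; `G₁` and `G₂` stand for `f'(r)` and
`f^*(f'(r))`. -/
theorem fDiv_eq {P Q : Measure Z} [IsProbabilityMeasure P] [IsProbabilityMeasure Q]
    (hPQ : P ≪ Q) {f : ℝ → ℝ} {G₁ G₂ : Z → ℝ} (h₁ : Measurable G₁) (h₂ : Measurable G₂) {B : ℝ}
    (hB₁ : ∀ z, |G₁ z| ≤ B) (hB₂ : ∀ z, |G₂ z| ≤ B)
    (hf : ∀ᵐ z ∂Q, f (ratio P Q z) = ratio P Q z * G₁ z - G₂ z) :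
    fDiv f P Q = ∫ z, G₁ z ∂P - ∫ z, G₂ z ∂Q := by
  rw [fDiv, integral_congr_ae hf, integral_sub, ← integral_rnDeriv_smul hPQ]
  · rfl
  · exact (integrable_rnDeriv_smul_iff hPQ).2 (integrable_of_measurable_of_abs_le P h₁ hB₁)
  · exact integrable_of_measurable_of_abs_le Q h₂ hB₂

/-- A union bound over four cylinders, valid for outer measure, so no set has to be measurable. -/
theorem sampleLaw_le_of_subset {P Q : Measure Z} [IsProbabilityMeasure P]
    [IsProbabilityMeasure Q] {m n m' n' : ℕ} {U : Set (Fin m → Z)} {V : Set (Fin n → Z)}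
    {U' : Set (Fin m' → Z)} {V' : Set (Fin n' → Z)}
    {T : Set ((Fin m → Z) × (Fin n → Z) × (Fin m' → Z) × (Fin n' → Z))}
    (hT : ∀ ω, ω.1 ∉ U → ω.2.1 ∉ V → ω.2.2.1 ∉ U' → ω.2.2.2 ∉ V' → ω ∉ T) :
    sampleLaw P Q m n m' n' T ≤ (Measure.pi fun _ => P) U + (Measure.pi fun _ => Q) V
      + (Measure.pi fun _ => P) U' + (Measure.pi fun _ => Q) V' := by
  have hsub : T ⊆ (((U ×ˢ univ) ∪ (univ ×ˢ (V ×ˢ univ))) ∪ (univ ×ˢ (univ ×ˢ (U' ×ˢ univ))))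
      ∪ (univ ×ˢ (univ ×ˢ (univ ×ˢ V'))) := fun ω hω => by
    by_contra hcon
    simp only [mem_union, mem_prod, mem_univ, true_and, and_true, not_or] at hcon
    exact hT ω hcon.1.1.1 hcon.1.1.2 hcon.1.2 hcon.2 hω
  refine (measure_mono hsub).trans ((measure_union_le _ _).trans (add_le_add
    ((measure_union_le _ _).trans (add_le_add ((measure_union_le _ _).trans (add_le_add ?_ ?_)) ?_))
    ?_)) <;> simp [sampleLaw, Measure.prod_prod]

end Averages

/-! ### From pointwise closeness to the deviation bound -/

section Divergence

variable {Z : Type*} [MeasurableSpace Z] {H : Type*} [NormedAddCommGroup H]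
  [InnerProductSpace ℝ H] [CompleteSpace H] [RKHS ℝ H Z ℝ]

/-- A deviation bound for the estimated divergence from pointwise bounds on the integrands. -/
theorem divergenceBound_of_close {P Q : Measure Z} [IsProbabilityMeasure P]
    [IsProbabilityMeasure Q] {f : ℝ → ℝ} {G₁ G₂ w₁ w₂ : Z → ℝ} (hG₁ : Measurable G₁)
    (hG₂ : Measurable G₂) (hw₁ : Measurable w₁) (hw₂ : Measurable w₂) {B B' δ A θ b η : ℝ}
    (hB₁ : ∀ z, |G₁ z| ≤ B) (hB₂ : ∀ z, |G₂ z| ≤ B)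
    (hB₁' : ∀ z, |w₁ z| ≤ B') (hB₂' : ∀ z, |w₂ z| ≤ B')
    (hδ₁ : ∫ z, w₁ z ∂P ≤ δ) (hδ₂ : ∫ z, w₂ z ∂Q ≤ δ)
    (hdiv : fDiv f P Q = ∫ z, G₁ z ∂P - ∫ z, G₂ z ∂Q) {m n m' n' : ℕ}
    (hbal : Balanced b m n m' n') (hη : η ∈ Ioo 0 (Real.exp (-1)))
    {U : Set (Fin m → Z)} {V : Set (Fin n → Z)}
    (hU : (Measure.pi fun _ => P) U ≤ ENNReal.ofReal (η / 8))
    (hV : (Measure.pi fun _ => Q) V ≤ ENNReal.ofReal (η / 8))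
    (h₁ : ∀ᵐ z ∂P, ∀ x ∉ U, ∀ y ∉ V,
      |rderiv f (ratioEst H (regParam θ m n) x y z) - G₁ z| ≤ w₁ z)
    (h₂ : ∀ᵐ z ∂Q, ∀ x ∉ U, ∀ y ∉ V,
      |conj f (rderiv f (ratioEst H (regParam θ m n) x y z)) - G₂ z| ≤ w₂ z)
    (hA : 2 * δ ≤ A * (rate θ m n * √(Real.log (1 / η)))) (hA' : 28 * (B + B') ≤ A) :
    DivergenceBound H f P Q θ A η m n m' n' := by
  obtain ⟨⟨-, -, hm', hn'⟩, -, -⟩ := hbal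
  obtain ⟨U', hU', hX⟩ := exists_average_sub_le P hG₁ hw₁ hB₁ hB₁' hδ₁ h₁ hm' hη
  obtain ⟨V', hV', hY⟩ := exists_average_sub_le Q hG₂ hw₂ hB₂ hB₂' hδ₂ h₂ hn' hη
  refine (sampleLaw_le_of_subset (U := U) (V := V) (U' := U') (V' := V') ?_).trans
    ((add_le_add (add_le_add (add_le_add hU hV) hU') hV').trans ?_)
  · rintro ⟨x, y, x', y'⟩ hx hy hx' hy'
    simp only at hx hy hx' hy'
    simp only [mem_ofPred_eq, not_not]
    obtain ⟨hX0, hX1⟩ := hX x' hx'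
    obtain ⟨hY0, hY1⟩ := hY y' hy'
    have hX2 := hX1 (fun z => rderiv f (ratioEst H (regParam θ m n) x y z))
      fun i => hX0 i x hx y hy
    have hY2 := hY1 (fun z => conj f (rderiv f (ratioEst H (regParam θ m n) x y z)))
      fun i => hY0 i x hx y hy
    set L := √(Real.log (1 / η)) with hL
    obtain ⟨z₀⟩ : Nonempty Z := P.nonempty_of_neZero
    have hBB : 0 ≤ B + B' :=
      add_nonneg ((abs_nonneg _).trans (hB₁ z₀)) ((abs_nonneg _).trans (hB₁' z₀))
    have hroot : ∀ {l : ℕ}, min m' n' ≤ l → 14 * (B + B') * L / √(l : ℝ)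
        ≤ 14 * (B + B') * L * ((min m' n' : ℕ) : ℝ) ^ (-(1 / 2) : ℝ) := fun hl => by
      rw [div_eq_mul_one_div]
      exact mul_le_mul_of_nonneg_left (one_div_sqrt_le_rpow_min hm' hn' hl) (by positivity)
    have h3 := hroot (min_le_left m' n')
    have h4 := hroot (min_le_right m' n')
    set τ := ((min m' n' : ℕ) : ℝ) ^ (-(1 / 2) : ℝ)
    have hτ : 0 ≤ τ * L := by positivity
    have h5 := mul_le_mul_of_nonneg_right hA' hτ
    rw [hdiv, divEst]
    have h6 : ∀ a b c d : ℝ, |a - b - (c - d)| ≤ |a - c| + |b - d| := fun a b c d => by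
      rw [sub_sub_sub_comm]; exact abs_sub _ _
    refine (h6 _ _ _ _).trans ((add_le_add hX2 hY2).trans ?_)
    nlinarith
  -- The failure probabilities `η/8`, `η/8`, `η/4`, `η/4` sum to `3η/4`.
  · rw [← ENNReal.ofReal_add, ← ENNReal.ofReal_add, ← ENNReal.ofReal_add]
    · exact ENNReal.ofReal_le_ofReal (by linarith [hη.1])
    all_goals linarith [hη.1]

end Divergence

/-! ### Derivatives and conjugates of the generators -/

section Generators

/-- The maximizer also bounds the family above, without which a real supremum would take its default
value. -/
theorem conj_eq_of_isMax {f : ℝ → ℝ} {u t : ℝ} (ht : 0 < t)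
    (h : ∀ s, 0 < s → u * s - f s ≤ u * t - f t) : conj f u = u * t - f t := by
  refine le_antisymm (ciSup_le fun s => h s s.2) ?_
  exact le_ciSup (f := fun s : Ioi (0 : ℝ) => u * (s : ℝ) - f s)
    ⟨u * t - f t, by rintro _ ⟨s, rfl⟩; exact h s s.2⟩ ⟨t, ht⟩

theorem rderiv_eq_deriv {f : ℝ → ℝ} {t : ℝ} (h : DifferentiableAt ℝ f t) :
    rderiv f t = deriv f t :=
  h.derivWithin (uniqueDiffWithinAt_Ioi t)

/-- The tangent line at `t` supports `f`, so the supremum is attained at `t`. -/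
theorem conj_rderiv_of_convexOn {f : ℝ → ℝ} (hf : ConvexOn ℝ (Ioi 0) f) {t : ℝ} (ht : 0 < t)
    (hd : DifferentiableAt ℝ f t) : conj f (rderiv f t) = t * deriv f t - f t := by
  rw [rderiv_eq_deriv hd, conj_eq_of_isMax ht fun s hs => ?_, mul_comm]
  rcases lt_trichotomy s t with hst | rfl | hst
  · have := hf.slope_le_deriv hs ht hst hd
    rw [slope_def_field, div_le_iff₀ (by linarith)] at this
    linarith
  · exact le_rfl
  · have := hf.deriv_le_slope ht hs hst hd
    rw [slope_def_field, le_div_iff₀ (by linarith)] at this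
    linarith

theorem rderiv_piecewise_affine {f : ℝ → ℝ} {α α' β β' γ : ℝ}
    (h₁ : ∀ s, γ ≤ s → f s = α * s + α') (h₂ : ∀ s, s ≤ γ → f s = β * s + β') (t : ℝ) :
    rderiv f t = if γ ≤ t then α else β := by
  have haff : ∀ a a' : ℝ, HasDerivAt (fun s : ℝ => a * s + a') a t := fun a a' => by
    simpa using ((hasDerivAt_id t).const_mul a).add_const a'
  split_ifs with ht
  · refine HasDerivWithinAt.derivWithin ?_ (uniqueDiffWithinAt_Ioi t)
    exact (haff α α').hasDerivWithinAt.congr (fun s hs => h₁ s (ht.trans (le_of_lt hs))) (h₁ t ht)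
  · refine HasDerivWithinAt.derivWithin ?_ (uniqueDiffWithinAt_Ioi t)
    refine ((haff β β').congr_of_eventuallyEq ?_).hasDerivWithinAt
    filter_upwards [Iio_mem_nhds (not_le.1 ht)] with s hs
    exact h₂ s (le_of_lt hs)

theorem rderiv_tvGen (t : ℝ) : rderiv tvGen t = -(1 / 2) + if 1 ≤ t then 1 else 0 := by
  rw [rderiv_piecewise_affine (f := tvGen) (γ := 1) (α := 1 / 2) (α' := -(1 / 2))
    (β := -(1 / 2)) (β' := 1 / 2)]
  · split_ifs <;> norm_num
  · intro s hs
    rw [tvGen, abs_of_nonneg (by linarith)]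
    ring
  · intro s hs
    rw [tvGen, abs_of_nonpos (by linarith)]
    ring

/-- Both slopes `±1/2` are subgradients at the kink, so the maximizer is always `1`. The factor `1
*` matches the common form with threshold `γ`. -/
theorem conj_rderiv_tvGen (t : ℝ) :
    conj tvGen (rderiv tvGen t) = -(1 / 2) + 1 * if 1 ≤ t then 1 else 0 := by
  rw [rderiv_tvGen]
  split_ifs
  · rw [conj_eq_of_isMax one_pos fun s _ => ?_]
    · norm_num [tvGen]
    · have := le_abs_self (s - 1)
      norm_num [tvGen]
      linarith
  · rw [conj_eq_of_isMax one_pos fun s _ => ?_]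
    · norm_num [tvGen]
    · have := neg_abs_le (s - 1)
      norm_num [tvGen]
      linarith

theorem tvGen_eq (t : ℝ) : tvGen t = t * (-(1 / 2) + if 1 ≤ t then 1 else 0)
    - (-(1 / 2) + 1 * if 1 ≤ t then 1 else 0) := by
  rw [tvGen]
  split_ifs with h
  · rw [abs_of_nonneg (by linarith)]; ring
  · rw [abs_of_nonpos (by linarith)]; ring

theorem rderiv_hsGen (γ t : ℝ) : rderiv (hsGen γ) t = 0 + if γ ≤ t then 1 else 0 := by
  rw [rderiv_piecewise_affine (f := hsGen γ) (γ := γ) (α := 1) (α' := -γ) (β := 0) (β' := 0),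
    zero_add]
  · intro s hs
    rw [hsGen, max_eq_left (by linarith)]
    ring
  · intro s hs
    rw [hsGen, max_eq_right (by linarith)]
    ring

/-- Both slopes `0` and `1` are subgradients at the kink `γ`, which is therefore a maximizer. -/
theorem conj_rderiv_hsGen {γ : ℝ} (hγ : 0 < γ) (t : ℝ) :
    conj (hsGen γ) (rderiv (hsGen γ) t) = 0 + γ * if γ ≤ t then 1 else 0 := by
  rw [rderiv_hsGen]
  split_ifs
  · rw [conj_eq_of_isMax hγ fun s _ => ?_]
    · simp [hsGen]
    · have := le_max_left (s - γ) 0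
      simp only [hsGen, sub_self, max_self]
      linarith
  · rw [conj_eq_of_isMax hγ fun s _ => ?_]
    · simp [hsGen]
    · have := le_max_right (s - γ) 0
      simp only [hsGen, sub_self, max_self]
      linarith

theorem hsGen_eq (γ t : ℝ) : hsGen γ t = t * (0 + if γ ≤ t then 1 else 0)
    - (0 + γ * if γ ≤ t then 1 else 0) := by
  rw [hsGen]
  split_ifs with h
  · rw [max_eq_left (by linarith)]; ring
  · rw [max_eq_right (by linarith)]; ring

end Generators

/-! ### Smooth and step-type generators -/

section Divergence

variable {Z : Type*} [MeasurableSpace Z] {H : Type*} [NormedAddCommGroup H]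
  [InnerProductSpace ℝ H] [CompleteSpace H] [RKHS ℝ H Z ℝ]

/-- The deviation bound for generators of class `C²`. -/
theorem exists_divergenceBound_of_contDiffOn {P Q : Measure Z} [IsProbabilityMeasure P]
    [IsProbabilityMeasure Q] (hPQ : P ≪ Q) {θ b : ℝ} {r : Z → ℝ} (hrm : Measurable r)
    (hr : ∀ᵐ z ∂Q, ratio P Q z = r z) {C₀ : ℝ} (hC₀ : 0 < C₀)
    (hunif : ∀ m n : ℕ, 1 ≤ m → 1 ≤ n → ∀ η ∈ Ioo (0 : ℝ) (Real.exp (-1)),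
      ∃ (U : Set (Fin m → Z)) (V : Set (Fin n → Z)),
        (Measure.pi fun _ => P) U ≤ ENNReal.ofReal (η / 8) ∧
        (Measure.pi fun _ => Q) V ≤ ENNReal.ofReal (η / 8) ∧
        ∀ x ∉ U, ∀ y ∉ V, ∀ u, |ratioEst H (regParam θ m n) x y u - r u|
          ≤ C₀ * rate θ m n * √(Real.log (1 / η)))
    {f : ℝ → ℝ} (hf : ConvexOn ℝ (Ioi 0) f) (hf2 : ContDiffOn ℝ 2 f (Ioi 0)) {c C : ℝ}
    (hc : 0 < c) (hcC : c ≤ C) (hrC : ∀ᵐ z ∂Q, ratio P Q z ∈ Icc c C) :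
    ∃ A : ℝ, 0 < A ∧ ∀ m n m' n' : ℕ, Balanced b m n m' n' →
      ∀ η ∈ Ioo (0 : ℝ) (Real.exp (-1)),
      2 * C₀ * rate θ m n * √(Real.log (1 / η)) ≤ c / 2 →
      DivergenceBound H f P Q θ A η m n m' n' := by
  have hdiff : ∀ t, 0 < t → DifferentiableAt ℝ f t := fun t ht =>
    (hf2.contDiffAt (Ioi_mem_nhds ht)).differentiableAt (by norm_num)
  have hd1 : ContDiffOn ℝ 1 (deriv f) (Ioi 0) := hf2.deriv_of_isOpen isOpen_Ioi (by norm_num)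
  set g : ℝ → ℝ := fun t => t * deriv f t - f t with hg
  have hg1 : ContDiffOn ℝ 1 g (Ioi 0) :=
    (contDiffOn_id.mul hd1).sub (hf2.of_le (by norm_num))
  have hsub : Icc (c / 2) (C + c / 2) ⊆ Ioi 0 := fun t ht => by
    have := ht.1
    simp only [mem_Ioi]
    linarith
  obtain ⟨M₁, hM₁⟩ := (hd1.mono hsub).exists_lipschitzOnWith one_ne_zero (convex_Icc _ _)
    isCompact_Icc
  obtain ⟨M₂, hM₂⟩ := (hg1.mono hsub).exists_lipschitzOnWith one_ne_zero (convex_Icc _ _)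
    isCompact_Icc
  set M : ℝ := max M₁ M₂ with hM
  have hM0 : 0 ≤ M := M₁.2.trans (le_max_left _ _)
  obtain ⟨B₁, hB₁⟩ := isCompact_Icc.exists_bound_of_continuousOn (hd1.mono hsub).continuousOn
  obtain ⟨B₂, hB₂⟩ := isCompact_Icc.exists_bound_of_continuousOn (hg1.mono hsub).continuousOn
  -- Clamping to `[c, C]` makes the population integrands bounded everywhere, although `r` lies in
  -- `[c, C]` only almost everywhere.
  let p : ℝ → ℝ := fun t => max c (min C t)
  have hp : Continuous p := by fun_prop
  have hpmem : ∀ t, p t ∈ Icc c C := fun t => ⟨le_max_left _ _, max_le hcC (min_le_left _ _)⟩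
  have hpeq : ∀ t ∈ Icc c C, p t = t := fun t ht => by
    simp only [p, min_eq_right ht.2, max_eq_right ht.1]
  have hsub' : Icc c C ⊆ Icc (c / 2) (C + c / 2) := Icc_subset_Icc (by linarith) (by linarith)
  have hdp : Continuous fun t => deriv f (p t) :=
    (hd1.mono hsub).continuousOn.comp_continuous hp fun t => hsub' (hpmem t)
  have hgp : Continuous fun t => g (p t) :=
    (hg1.mono hsub).continuousOn.comp_continuous hp fun t => hsub' (hpmem t)
  set B : ℝ := max B₁ B₂
  have hrQ : ∀ᵐ z ∂Q, r z ∈ Icc c C := by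
    filter_upwards [hr, hrC] with z h1 h2
    rwa [← h1]
  have hrP : ∀ᵐ z ∂P, r z ∈ Icc c C := hPQ.ae_le hrQ
  have hG₁ : Measurable fun z => deriv f (p (r z)) := hdp.measurable.comp hrm
  have hG₂ : Measurable fun z => g (p (r z)) := hgp.measurable.comp hrm
  have hb₁ : ∀ z, |deriv f (p (r z))| ≤ B := fun z =>
    (hB₁ _ (hsub' (hpmem _))).trans (le_max_left _ _)
  have hb₂ : ∀ z, |g (p (r z))| ≤ B := fun z =>
    (hB₂ _ (hsub' (hpmem _))).trans (le_max_right _ _)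
  have hdiv := fDiv_eq (f := f) hPQ hG₁ hG₂ hb₁ hb₂ (by
    filter_upwards [hr, hrQ] with z h1 h2
    rw [h1, hpeq _ h2]
    simp only [hg]
    ring)
  obtain ⟨z₀⟩ : Nonempty Z := P.nonempty_of_neZero
  have hB0 : 0 ≤ B := (abs_nonneg _).trans (hb₁ z₀)
  -- `2 M C₀` covers the Lipschitz errors of both averages, and `28 = 2 * 14` their fluctuations,
  -- with `w` at most `M * (c / 2)`.
  refine ⟨2 * M * C₀ + 28 * (B + M * (c / 2)) + 1, by positivity,
    fun m n m' n' hbal η hη hcond => ?_⟩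
  obtain ⟨U, V, hU, hV, hUV⟩ := hunif m n hbal.1.1 hbal.1.2.1 η hη
  have hρ := rate_pos (θ := θ) hbal.1.1 hbal.1.2.1
  have hL := one_le_sqrt_log hη
  set ρ := rate θ m n
  set L := √(Real.log (1 / η))
  set ε : ℝ := C₀ * ρ * L with hε
  have hε0 : 0 ≤ ε := by positivity
  have hεc : ε ≤ c / 2 := by linarith
  have hclose : ∀ {t s : ℝ}, s ∈ Icc c C → |t - s| ≤ ε → t ∈ Icc (c / 2) (C + c / 2) :=
    fun hs hts => by
      have := abs_le.1 hts
      constructor <;> linarith [hs.1, hs.2]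
  have hlip : ∀ {φ : ℝ → ℝ} {M' : NNReal}, LipschitzOnWith M' φ (Icc (c / 2) (C + c / 2)) →
      (M' : ℝ) ≤ M → ∀ {t s : ℝ}, s ∈ Icc c C → |t - s| ≤ ε → |φ t - φ s| ≤ M * ε :=
    fun hφ hM' t s hs hts => by
      have := hφ.dist_le_mul t (hclose hs hts) s (hsub' hs)
      rw [Real.dist_eq, Real.dist_eq] at this
      exact this.trans (mul_le_mul hM' hts (abs_nonneg _) hM0)
  have hw : ∀ _ : Z, |M * ε| ≤ M * (c / 2) := fun _ => by
    rw [abs_of_nonneg (by positivity)]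
    gcongr
  refine divergenceBound_of_close hG₁ hG₂ (w₁ := fun _ => M * ε) (w₂ := fun _ => M * ε)
    measurable_const measurable_const hb₁ hb₂ hw hw (δ := M * ε) (by simp) (by simp) hdiv hbal hη
    hU hV ?_ ?_ ?_ ?_
  · filter_upwards [hrP] with z hz x hx y hy
    have h1 := hUV x hx y hy z
    rw [rderiv_eq_deriv (hdiff _ (hsub (hclose hz h1))), hpeq _ hz]
    exact hlip hM₁ (le_max_left _ _) hz h1
  · filter_upwards [hrQ] with z hz x hx y hy
    have h1 := hUV x hx y hy z
    have h2 := hsub (hclose hz h1)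
    rw [conj_rderiv_of_convexOn hf h2 (hdiff _ h2), hpeq _ hz]
    exact hlip hM₂ (le_max_right _ _) hz h1
  · have : 0 ≤ (28 * (B + M * (c / 2)) + 1) * (ρ * L) := by positivity
    rw [hε]
    linarith
  · have : 0 ≤ 2 * M * C₀ := by positivity
    linarith

/-- A bounded density of the estimated ratio near `γ` bounds the mass that the true ratio has
near `γ`. -/
theorem measureReal_abs_sub_le_of_density (hk : Measurable fun p : Z × Z => ker H p.1 p.2)
    {P Q R : Measure Z} [IsProbabilityMeasure P] [IsProbabilityMeasure Q]
    [IsProbabilityMeasure R] {r : Z → ℝ} {m n : ℕ} {lam η ε γ G : ℝ}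
    (hη : η ∈ Ioo 0 (Real.exp (-1))) {U : Set (Fin m → Z)} {V : Set (Fin n → Z)}
    (hU : (Measure.pi fun _ => P) U ≤ ENNReal.ofReal (η / 8))
    (hV : (Measure.pi fun _ => Q) V ≤ ENNReal.ofReal (η / 8))
    (hUV : ∀ x ∉ U, ∀ y ∉ V, ∀ u, |ratioEst H lam x y u - r u| ≤ ε) (hε : 0 ≤ ε)
    (hεγ : 2 * ε ≤ γ / 2)
    (hG : HasBoundedDensityOn (ratioEstLaw H P Q R m n lam) (Icc (γ / 2) (3 * γ / 2)) G) :
    R.real {z | |r z - γ| ≤ ε} ≤ 8 * max G 0 * ε := by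
  set W := {z | |r z - γ| ≤ ε}
  -- One `ε` for the distance of `r` to `γ`, one for the error of the estimate.
  set J := Icc (γ - 2 * ε) (γ + 2 * ε)
  have hJ : J ⊆ Icc (γ / 2) (3 * γ / 2) := Icc_subset_Icc (by linarith) (by linarith)
  obtain ⟨d, -, hdG, hd⟩ := hG
  have hlawJ : ratioEstLaw H P Q R m n lam J ≤ ENNReal.ofReal (max G 0 * (4 * ε)) := by
    have h1 : ratioEstLaw H P Q R m n lam J
        = (ratioEstLaw H P Q R m n lam).restrict (Icc (γ / 2) (3 * γ / 2)) J := by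
      rw [Measure.restrict_apply measurableSet_Icc, inter_eq_left.2 hJ]
    rw [h1, hd, Measure.restrict_apply measurableSet_Icc, inter_eq_left.2 hJ,
      withDensity_apply _ measurableSet_Icc]
    calc ∫⁻ t in J, d t ≤ ∫⁻ _ in J, ENNReal.ofReal (max G 0) :=
          setLIntegral_mono measurable_const fun t ht =>
            (hdG t (hJ ht)).trans (ENNReal.ofReal_le_ofReal (le_max_left _ _))
      _ = ENNReal.ofReal (max G 0 * (4 * ε)) := by
          rw [setLIntegral_const, Real.volume_Icc, ← ENNReal.ofReal_mul (le_max_right _ _)]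
          congr 2
          ring
  have hprod : (Measure.pi fun _ => P) Uᶜ * ((Measure.pi fun _ => Q) Vᶜ * R W)
      ≤ ratioEstLaw H P Q R m n lam J := by
    rw [← Measure.prod_prod, ← Measure.prod_prod, ratioEstLaw,
      Measure.map_apply (measurable_ratioEst hk m n lam) measurableSet_Icc]
    refine measure_mono ?_
    rintro ⟨x, y, z⟩ ⟨hx, hy, hz⟩
    have h1 := abs_le.1 (hUV x hx y hy z)
    have h2 := abs_le.1 (show |r z - γ| ≤ ε from hz)
    constructor <;> simp only <;> linarith [h1.1, h1.2, h2.1, h2.2]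
  have hη1 : η < 1 := hη.2.trans (by rw [Real.exp_lt_one_iff]; norm_num)
  -- Each good event has probability at least `7/8`, uniformly in `η`. Dividing the mass `4 ε max G
  -- 0` of `J` by `(7/8) ^ 2` stays below the factor `8`.
  have hcompl : ∀ {Ω : Type _} [MeasurableSpace Ω] (μ : Measure Ω) [IsProbabilityMeasure μ]
      (S : Set Ω), μ S ≤ ENNReal.ofReal (η / 8) → 7 / 8 ≤ μ.real Sᶜ := fun μ _ S hS => by
    have h1 : μ.real univ ≤ μ.real S + μ.real Sᶜ := by
      rw [← union_compl_self S]; exact measureReal_union_le _ _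
    have h2 : μ.real S ≤ η / 8 := ENNReal.toReal_le_of_le_ofReal (by linarith [hη.1]) hS
    rw [probReal_univ] at h1
    linarith
  have h1 := ENNReal.toReal_le_of_le_ofReal (by positivity) (hprod.trans hlawJ)
  rw [ENNReal.toReal_mul, ENNReal.toReal_mul] at h1
  have h2 := hcompl _ U hU
  have h3 := hcompl _ V hV
  simp only [measureReal_def] at h2 h3 ⊢
  set u := ((Measure.pi fun _ => P) Uᶜ).toReal
  set v := ((Measure.pi fun _ => Q) Vᶜ).toReal
  have h4 : 7 / 8 * (7 / 8 * (R W).toReal) ≤ u * (v * (R W).toReal) := by gcongr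
  have h5 : 0 ≤ max G 0 * ε := by positivity
  linarith

/-- The deviation bound for generators whose derivative is a step function. -/
theorem exists_divergenceBound_of_step (hk : Measurable fun p : Z × Z => ker H p.1 p.2)
    {P Q : Measure Z} [IsProbabilityMeasure P]
    [IsProbabilityMeasure Q] (hPQ : P ≪ Q) {θ b : ℝ} {r : Z → ℝ} (hrm : Measurable r)
    (hr : ∀ᵐ z ∂Q, ratio P Q z = r z) {C₀ : ℝ} (hC₀ : 0 < C₀)
    (hunif : ∀ m n : ℕ, 1 ≤ m → 1 ≤ n → ∀ η ∈ Ioo (0 : ℝ) (Real.exp (-1)),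
      ∃ (U : Set (Fin m → Z)) (V : Set (Fin n → Z)),
        (Measure.pi fun _ => P) U ≤ ENNReal.ofReal (η / 8) ∧
        (Measure.pi fun _ => Q) V ≤ ENNReal.ofReal (η / 8) ∧
        ∀ x ∉ U, ∀ y ∉ V, ∀ u, |ratioEst H (regParam θ m n) x y u - r u|
          ≤ C₀ * rate θ m n * √(Real.log (1 / η)))
    {f : ℝ → ℝ} {a γ : ℝ} (hγ : 0 < γ) (h₁ : ∀ t, rderiv f t = a + if γ ≤ t then 1 else 0)
    (h₂ : ∀ t, conj f (rderiv f t) = a + γ * if γ ≤ t then 1 else 0)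
    (hf : ∀ t, f t = t * (a + if γ ≤ t then 1 else 0) - (a + γ * if γ ≤ t then 1 else 0))
    (G : ℝ) :
    ∃ A : ℝ, 0 < A ∧ ∀ m n m' n' : ℕ, Balanced b m n m' n' →
      ∀ η ∈ Ioo (0 : ℝ) (Real.exp (-1)),
      HasBoundedDensityOn (ratioEstLaw H P Q P m n (regParam θ m n))
        (Icc (γ / 2) (3 * γ / 2)) G →
      HasBoundedDensityOn (ratioEstLaw H P Q Q m n (regParam θ m n))
        (Icc (γ / 2) (3 * γ / 2)) G →
      2 * C₀ * rate θ m n * √(Real.log (1 / η)) ≤ γ / 2 →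
      DivergenceBound H f P Q θ A η m n m' n' := by
  let s : ℝ → ℝ := fun t => if γ ≤ t then 1 else 0
  have hs : Measurable s := Measurable.ite measurableSet_Ici measurable_const measurable_const
  have hs1 : ∀ t, |s t| ≤ 1 := fun t => by
    simp only [s]; split_ifs <;> simp
  have hsr : Measurable fun z => s (r z) := hs.comp hrm
  have hG₁ : Measurable fun z => a + s (r z) := hsr.const_add a
  have hG₂ : Measurable fun z => a + γ * s (r z) := (hsr.const_mul γ).const_add a
  have hb₁ : ∀ z, |a + s (r z)| ≤ |a| + 1 + γ := fun z => by
    have := (abs_add_le a (s (r z))).trans (add_le_add_right (hs1 (r z)) _)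
    linarith
  have hb₂ : ∀ z, |a + γ * s (r z)| ≤ |a| + 1 + γ := fun z => by
    have h1 := abs_add_le a (γ * s (r z))
    have h2 := mul_le_mul_of_nonneg_left (hs1 (r z)) hγ.le
    rw [abs_mul, abs_of_pos hγ] at h1
    linarith
  have hdiv := fDiv_eq (f := f) hPQ hG₁ hG₂ hb₁ hb₂ (by
    filter_upwards [hr] with z hz
    rw [hz, hf])
  have hmax : 0 ≤ max G 0 := le_max_right _ _
  refine ⟨2 * ((1 + γ) * (8 * max G 0 * C₀)) + 28 * (|a| + 1 + γ + (1 + γ)), by positivity,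
    fun m n m' n' hbal η hη hGP hGQ hcond => ?_⟩
  obtain ⟨U, V, hU, hV, hUV⟩ := hunif m n hbal.1.1 hbal.1.2.1 η hη
  have hρ := rate_pos (θ := θ) hbal.1.1 hbal.1.2.1
  have hL := one_le_sqrt_log hη
  set ρ := rate θ m n
  set L := √(Real.log (1 / η))
  set ε : ℝ := C₀ * ρ * L with hε
  have hε0 : 0 ≤ ε := by positivity
  have hεγ : 2 * ε ≤ γ / 2 := by linarith
  have hWP := measureReal_abs_sub_le_of_density hk hη hU hV hUV hε0 hεγ hGP
  have hWQ := measureReal_abs_sub_le_of_density hk hη hU hV hUV hε0 hεγ hGQ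
  set W := {z | |r z - γ| ≤ ε} with hW
  have hWm : MeasurableSet W := measurableSet_le (by fun_prop) measurable_const
  have hw : Measurable (W.indicator fun _ => (1 : ℝ)) := measurable_const.indicator hWm
  have hw0 : ∀ z, 0 ≤ W.indicator (fun _ => (1 : ℝ)) z := indicator_nonneg fun _ _ => zero_le_one
  have hw1 : ∀ z, W.indicator (fun _ => (1 : ℝ)) z ≤ 1 :=
    fun z => indicator_le_self' (fun _ _ => zero_le_one) z
  -- Off `W`, the numbers `t` and `r z` lie on the same side of `γ`; on `W` the step changes by at
  -- most `1`.
  have hstep : ∀ z t, |t - r z| ≤ ε → |s t - s (r z)| ≤ W.indicator (fun _ => (1 : ℝ)) z :=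
    fun z t ht => by
      have h := abs_le.1 ht
      by_cases hz : z ∈ W
      · rw [indicator_of_mem hz]
        simp only [s]
        split_ifs <;> simp
      · rw [indicator_of_notMem hz]
        have hz' : ε < |r z - γ| := not_le.1 hz
        have heq : s t = s (r z) := by
          simp only [s]
          rcases lt_abs.1 hz' with h1 | h1
          · rw [if_pos (by linarith), if_pos (by linarith)]
          · rw [if_neg (by linarith), if_neg (by linarith)]
        simp [heq]
  have hε8 : 0 ≤ 8 * max G 0 * ε := by positivity
  refine divergenceBound_of_close (δ := (1 + γ) * (8 * max G 0 * ε)) (B' := 1 + γ) hG₁ hG₂ hw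
    (hw.const_mul γ) hb₁ hb₂ (fun z => ?_) (fun z => ?_) ?_ ?_ hdiv hbal hη hU hV ?_ ?_ ?_ ?_
  · rw [abs_of_nonneg (hw0 z)]
    linarith [hw1 z]
  · rw [abs_of_nonneg (mul_nonneg hγ.le (hw0 z))]
    nlinarith [hw1 z]
  · rw [integral_indicator_const _ hWm, smul_eq_mul, mul_one]
    nlinarith
  · rw [integral_const_mul, integral_indicator_const _ hWm, smul_eq_mul, mul_one]
    nlinarith
  · refine Filter.Eventually.of_forall fun z x hx y hy => ?_
    rw [h₁, add_sub_add_left_eq_sub]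
    exact hstep z _ (hUV x hx y hy z)
  · refine Filter.Eventually.of_forall fun z x hx y hy => ?_
    rw [h₂, add_sub_add_left_eq_sub, ← mul_sub, abs_mul, abs_of_pos hγ]
    exact mul_le_mul_of_nonneg_left (hstep z _ (hUV x hx y hy z)) hγ.le
  · have : 0 ≤ 28 * (|a| + 1 + γ + (1 + γ)) * (ρ * L) := by positivity
    rw [hε]
    linarith
  · have : 0 ≤ 2 * ((1 + γ) * (8 * max G 0 * C₀)) := by positivity
    linarith

end Divergence

end FDivEst

end

theorem lemma2
    {Z : Type*} [MeasurableSpace Z]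
    (P Q : Measure Z) [IsProbabilityMeasure P] [IsProbabilityMeasure Q] (hPQ : P ≪ Q)
    {H : Type*} [NormedAddCommGroup H] [InnerProductSpace ℝ H] [CompleteSpace H] [RKHS ℝ H Z ℝ]
    (hk : Measurable fun p : Z × Z => FDivEst.ker H p.1 p.2)
    (K : ℝ) (hK : ∀ x y : Z, |FDivEst.ker H x y| ≤ K)
    (hr : ∃ h : H, ∀ᵐ z ∂Q, FDivEst.ratio P Q z - 1 = h z)
    (θ : ℝ) (hθ : θ ∈ Set.Ioc (1 : ℝ) 2)
    (hsrc : FDivEst.meanEmbedding H P - FDivEst.meanEmbedding H Q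
      ∈ FDivEst.powRange (FDivEst.covOp H Q) θ)
    (b : ℝ) :
    ∃ C₁ : ℝ, 0 < C₁ ∧
      -- generators of class C²
      (∀ f : ℝ → ℝ, ConvexOn ℝ (Set.Ioi 0) f → f 1 = 0 → ContDiffOn ℝ 2 f (Set.Ioi 0) →
        ∀ c C : ℝ, 0 < c → c < 1 → 1 < C →
        (∀ᵐ z ∂Q, FDivEst.ratio P Q z ∈ Set.Icc c C) →
        ∃ A : ℝ, 0 < A ∧ ∀ m n m' n' : ℕ, FDivEst.Balanced b m n m' n' →
          ∀ η ∈ Set.Ioo (0 : ℝ) (Real.exp (-1)),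
          C₁ * FDivEst.rate θ m n * √(Real.log (1 / η)) ≤ c / 2 →
          FDivEst.DivergenceBound H f P Q θ A η m n m' n') ∧
      -- Total Variation, with threshold 1
      (∀ G : ℝ, ∃ A : ℝ, 0 < A ∧ ∀ m n m' n' : ℕ, FDivEst.Balanced b m n m' n' →
          ∀ η ∈ Set.Ioo (0 : ℝ) (Real.exp (-1)),
          FDivEst.HasBoundedDensityOn
            (FDivEst.ratioEstLaw H P Q P m n (FDivEst.regParam θ m n))
            (Set.Icc (1 / 2) (3 / 2)) G →
          FDivEst.HasBoundedDensityOn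
            (FDivEst.ratioEstLaw H P Q Q m n (FDivEst.regParam θ m n))
            (Set.Icc (1 / 2) (3 / 2)) G →
          C₁ * FDivEst.rate θ m n * √(Real.log (1 / η)) ≤ 1 / 2 →
          FDivEst.DivergenceBound H FDivEst.tvGen P Q θ A η m n m' n') ∧
      -- Hockey-Stick, with threshold γ
      (∀ γ : ℝ, 0 < γ → ∀ G : ℝ, ∃ A : ℝ, 0 < A ∧ ∀ m n m' n' : ℕ,
          FDivEst.Balanced b m n m' n' →
          ∀ η ∈ Set.Ioo (0 : ℝ) (Real.exp (-1)),
          FDivEst.HasBoundedDensityOn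
            (FDivEst.ratioEstLaw H P Q P m n (FDivEst.regParam θ m n))
            (Set.Icc (γ / 2) (3 * γ / 2)) G →
          FDivEst.HasBoundedDensityOn
            (FDivEst.ratioEstLaw H P Q Q m n (FDivEst.regParam θ m n))
            (Set.Icc (γ / 2) (3 * γ / 2)) G →
          C₁ * FDivEst.rate θ m n * √(Real.log (1 / η)) ≤ γ / 2 →
          FDivEst.DivergenceBound H (FDivEst.hsGen γ) P Q θ A η m n m' n') := by
  obtain ⟨h, C₀, hC₀, hrh, hunif⟩ := FDivEst.exists_uniform_bound hk hK hPQ hr hθ hsrc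
  have hrm : Measurable fun z => h z + 1 := (FDivEst.measurable_coe hk h).add_const 1
  -- The factor `2` is needed for the step generators, where the window of radius `2ε` must fit in
  -- `[γ/2, 3γ/2]`; the smooth case needs only `ε ≤ c/2`.
  refine ⟨2 * C₀, by positivity, fun f hf _ hf2 c C hc hc1 hC1 hrC => ?_, fun G => ?_,
    fun γ hγ G => ?_⟩
  · exact FDivEst.exists_divergenceBound_of_contDiffOn hPQ hrm hrh hC₀ hunif hf hf2 hc
      (hc1.trans hC1).le hrC
  · simpa only [mul_one] using FDivEst.exists_divergenceBound_of_step (b := b) hk hPQ hrm hrh hC₀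
      hunif one_pos FDivEst.rderiv_tvGen FDivEst.conj_rderiv_tvGen FDivEst.tvGen_eq G
  · exact FDivEst.exists_divergenceBound_of_step hk hPQ hrm hrh hC₀ hunif hγ
      (FDivEst.rderiv_hsGen γ) (FDivEst.conj_rderiv_hsGen hγ) (FDivEst.hsGen_eq γ) G
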